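/- Let $A\in\mathbb{Q}^{n\times n}$ be expanding (all complex eigenvalues satisfy $|z|>1$) and put $B:=A^{-1}$. For an invertible $C\in\mathbb{Q}^{n\times n}$ let $\mathbb{Z}^n[C]:=\sum_{k\ge 0}C^k\mathbb{Z}^n\subset\mathbb{Q}^n$ and $\mathbb{Z}^n(C):=\sum_{k\in\mathbb{Z}}C^k\mathbb{Z}^n$, and let $b:=|\mathbb{Z}^n[B]/B\,\mathbb{Z}^n[B]|$. For $y\in\mathbb{Z}^n(B)$ let $\nu(y)$ be the minimal $k\in\mathbb{Z}$ with $y\in B^k\mathbb{Z}^n[B]\setminus B^{k+1}\mathbb{Z}^n[B]$, with $\nu(y)=\infty$ if there is no such $k$ (in particular $\nu(0)=\infty$), and let $\mathbf{d}_B(y,y'):=b^{-\nu(y-y')}$, where $b^{-\infty}:=0$. Let $\mathbb{Z}^n((B))$ be the (Hausdorff) completion of $\mathbb{Z}^n(B)$ with respect to the (pseudo)metric $\mathbf{d}_B$, on which $A$ acts by continuous extension, and let $\mu_B$ be the Haar measure on $\mathbb{Z}^n((B))$ that gives measure $1$ to $\mathbb{Z}^n[[B]]=\{y:\nu(y)\ge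 0\}$, where $\nu$ is extended continuously. Let $\mathbb{K}_A:=\mathbb{R}^n\times\mathbb{Z}^n((B))$ with the product topology, the action $A(x,y):=(Ax,Ay)$ and the measure $\mu:=\lambda\times\mu_B$, $\lambda$ being Lebesgue measure, and let $\varphi:\mathbb{Z}^n(B)\to\mathbb{K}_A$, $\varphi(x):=(x,x)$. Let $\mathcal{D}\subset\mathbb{Z}^n[A]$ be a finite set with $|\mathcal{D}|=|\mathbb{Z}^n[A]/A\,\mathbb{Z}^n[A]|$; that is, $(A,\mathcal{D})$ is a digit system. Then there is a unique nonempty compact set $\mathcal{F}=\mathcal{F}(A,\mathcal{D})\subset\mathbb{K}_A$ with $$A\mathcal{F}=\bigcup_{d\in\mathcal{D}}(\mathcal{F}+\varphi(d)),$$ and for this set $\mathcal{F}$ the following are equivalent: (i) $\mu(\mathcal{F})>0$; (ii) $\mathcal{F}$ has nonempty interior in $\mathbb{K}_A$; (iii) $\mathcal{F}$ is the closure of its interior, and $\mu(\partial\mathcal{F})=0$. -/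

import Mathlib

noncomputable section

namespace RationalTile

open MeasureTheory UniformSpace

variable {n : ℕ}

/-! ### Expanding matrices and the associated modules -/

/-- All (complex) eigenvalues of `A` have modulus greater than `1`. -/
def IsExpanding (A : Matrix (Fin n) (Fin n) ℚ) : Prop :=
  ∀ z ∈ spectrum ℂ (A.map (algebraMap ℚ ℂ)), 1 < ‖z‖

/-- Expanding rational `n × n` matrices. -/
abbrev ExpandingMatrix (n : ℕ) : Type :=
  {A : Matrix (Fin n) (Fin n) ℚ // IsExpanding A}

/-- Multiplication by `C` on `ℚⁿ`. -/
def matMap (C : Matrix (Fin n) (Fin n) ℚ) : (Fin n → ℚ) →+ (Fin n → ℚ) :=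
  C.mulVecLin.toAddMonoidHom

/-- The inclusion `ℤⁿ → ℚⁿ`. -/
def castVec (n : ℕ) : (Fin n → ℤ) →+ (Fin n → ℚ) :=
  (Int.castAddHom ℚ).compLeft (Fin n)

/-- `ℤⁿ` as a subgroup of `ℚⁿ`. -/
def intVectors (n : ℕ) : AddSubgroup (Fin n → ℚ) := (castVec n).range

/-- `ℤⁿ[C]`, the sum of all `Cᵏ ℤⁿ` with `k ≥ 0`. -/
def polyModule (C : Matrix (Fin n) (Fin n) ℚ) : AddSubgroup (Fin n → ℚ) :=
  ⨆ k : ℕ, (intVectors n).map (matMap (C ^ k))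

/-- `ℤⁿ(C)`, the sum of all `Cᵏ ℤⁿ` with `k ∈ ℤ`. -/
def laurentModule (C : Matrix (Fin n) (Fin n) ℚ) : AddSubgroup (Fin n → ℚ) :=
  ⨆ k : ℤ, (intVectors n).map (matMap (C ^ k))

/-- The order of the quotient group `ℤⁿ[C] / C ℤⁿ[C]`. -/
def residueCard (C : Matrix (Fin n) (Fin n) ℚ) : ℕ :=
  Nat.card (polyModule C ⧸ ((polyModule C).map (matMap C)).addSubgroupOf (polyModule C))

/-- `Cᵏ ℤⁿ[C]`, for `k ∈ ℤ`. -/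
def filt (C : Matrix (Fin n) (Fin n) ℚ) (k : ℤ) : AddSubgroup (Fin n → ℚ) :=
  (polyModule C).map (matMap (C ^ k))

open Classical in
/-- The `C`-adic valuation: the minimal `k` with `y ∈ Cᵏ ℤⁿ[C] \ Cᵏ⁺¹ ℤⁿ[C]`, and `∞` if there
is no such `k`, that is, if `y` lies in every `Cᵏ ℤⁿ[C]` (in particular if `y = 0`). -/
def adicVal (C : Matrix (Fin n) (Fin n) ℚ) (y : Fin n → ℚ) : WithTop ℤ :=
  if ∃ k : ℤ, y ∈ filt C k ∧ y ∉ filt C (k + 1) then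
    ((sInf {k : ℤ | y ∈ filt C k ∧ y ∉ filt C (k + 1)} : ℤ) : WithTop ℤ)
  else ⊤

/-- `b ^ (-ν y)` where `b` is the order of `ℤⁿ[C] / C ℤⁿ[C]` and `b ^ (-∞) = 0`. -/
def adicAbs (C : Matrix (Fin n) (Fin n) ℚ) (y : Fin n → ℚ) : ℝ :=
  WithTop.recTopCoe 0 (fun k : ℤ => (residueCard C : ℝ) ^ (-k)) (adicVal C y)

/-! ### Auxiliary facts about the modules and the valuation -/

theorem matMap_apply (C : Matrix (Fin n) (Fin n) ℚ) (v : Fin n → ℚ) :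
    matMap C v = C.mulVec v := rfl

theorem matMap_comp (C C' : Matrix (Fin n) (Fin n) ℚ) :
    (matMap C).comp (matMap C') = matMap (C * C') := by
  refine AddMonoidHom.ext fun v => ?_
  simp [matMap_apply, Matrix.mulVec_mulVec]

theorem matMap_one : matMap (1 : Matrix (Fin n) (Fin n) ℚ) = AddMonoidHom.id _ := by
  refine AddMonoidHom.ext fun v => ?_
  simp [matMap_apply]

theorem residueCard_eq (C : Matrix (Fin n) (Fin n) ℚ) :
    residueCard C = ((polyModule C).map (matMap C)).relIndex (polyModule C) := rfl

theorem isUnit_det (A : ExpandingMatrix n) : IsUnit A.1.det := by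
  rw [isUnit_iff_ne_zero]
  intro h0
  have h : (0 : ℂ) ∈ spectrum ℂ (A.1.map (algebraMap ℚ ℂ)) := by
    rw [spectrum.zero_mem_iff, Matrix.isUnit_iff_isUnit_det]
    have : (A.1.map (algebraMap ℚ ℂ)).det = algebraMap ℚ ℂ A.1.det :=
      ((algebraMap ℚ ℂ).map_det A.1).symm
    rw [this, h0]
    simp
  have := A.2 0 h
  simp at this
  linarith

theorem isUnit_det_inv (A : ExpandingMatrix n) : IsUnit (A.1⁻¹).det :=
  Matrix.isUnit_nonsing_inv_det _ (isUnit_det A)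

section facts

variable {C : Matrix (Fin n) (Fin n) ℚ}

theorem filt_zero : filt C 0 = polyModule C := by
  simp [filt, matMap_one]

theorem intVectors_le : intVectors n ≤ polyModule C := by
  have := le_iSup (fun k : ℕ => (intVectors n).map (matMap (C ^ k))) 0
  simp only [pow_zero, matMap_one, AddSubgroup.map_id] at this
  exact this

theorem polyModule_eq_sup :
    polyModule C = intVectors n ⊔ (polyModule C).map (matMap C) := by
  unfold polyModule
  rw [AddSubgroup.map_iSup]
  simp only [AddSubgroup.map_map, matMap_comp]
  conv_lhs => rw [← sup_iSup_nat_succ]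
  simp [matMap_one, pow_succ']

theorem map_polyModule_le : (polyModule C).map (matMap C) ≤ polyModule C := by
  conv_rhs => rw [polyModule_eq_sup]
  exact le_sup_right

theorem map_filt (hC : IsUnit C.det) (j k : ℤ) :
    (filt C k).map (matMap (C ^ j)) = filt C (j + k) := by
  rw [filt, filt, AddSubgroup.map_map, matMap_comp, Matrix.zpow_add hC]

theorem map_filt_one (hC : IsUnit C.det) (k : ℤ) :
    (filt C k).map (matMap C) = filt C (k + 1) := by
  have := map_filt hC 1 k
  rwa [zpow_one, add_comm] at this

theorem filt_succ_le (hC : IsUnit C.det) (k : ℤ) : filt C (k + 1) ≤ filt C k := by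
  have h1 : filt C (k + 1) = (filt C 1).map (matMap (C ^ k)) := (map_filt hC k 1).symm
  have h2 : filt C 1 = (polyModule C).map (matMap C) := by simp [filt]
  rw [h1, h2, filt]
  exact AddSubgroup.map_mono map_polyModule_le

theorem filt_antitone (hC : IsUnit C.det) : Antitone (filt C) :=
  antitone_int_of_succ_le (filt_succ_le hC)

theorem matMap_injective (hC : IsUnit C.det) : Function.Injective (matMap C) :=
  Matrix.mulVec_injective_of_isUnit ((Matrix.isUnit_iff_isUnit_det C).2 hC)

theorem relIndex_filt_succ (hC : IsUnit C.det) (k : ℤ) :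
    (filt C (k + 1)).relIndex (filt C k) = residueCard C := by
  have h1 : filt C (k + 1) = (filt C 1).map (matMap (C ^ k)) := (map_filt hC k 1).symm
  have h2 : filt C 1 = (polyModule C).map (matMap C) := by simp [filt]
  have h3 : Function.Injective (matMap (C ^ k)) := matMap_injective (hC.det_zpow k)
  rw [h1, h2, filt, AddSubgroup.relIndex_map_map_of_injective _ _ h3, residueCard_eq]

/-- The residue group of `ℤⁿ[C]` modulo `C` is finite. -/
theorem residueCard_ne_zero (hC : IsUnit C.det) : residueCard C ≠ 0 := by
  rw [residueCard_eq]
  have e : ((polyModule C).map (matMap C)).relIndex (polyModule C)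
      = ((polyModule C).map (matMap C)).relIndex (intVectors n) := by
    conv_lhs => arg 2; rw [polyModule_eq_sup]
    exact AddSubgroup.relIndex_sup_right _ _
  rw [e, intVectors, ← AddSubgroup.index_comap]
  set N := ((polyModule C).map (matMap C)).comap (castVec n) with hN
  obtain ⟨c, hc⟩ := IsLocalization.exist_integer_multiples_of_finite (nonZeroDivisors ℤ)
    (fun p : Fin n × Fin n => C⁻¹ p.1 p.2)
  choose g hg using hc
  have hmem : ∀ v : Fin n → ℤ, (c : ℤ) • v ∈ N := by
    intro v
    rw [hN, AddSubgroup.mem_comap]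
    refine ⟨castVec n ((Matrix.of fun i j => g (i, j)).mulVec v),
      intVectors_le ⟨_, rfl⟩, ?_⟩
    have h : castVec n ((Matrix.of fun i j => g (i, j)).mulVec v)
        = C⁻¹.mulVec (castVec n ((c : ℤ) • v)) := by
      ext i
      simp only [castVec, AddMonoidHom.compLeft_apply, Function.comp, Matrix.mulVec, dotProduct,
        Matrix.of_apply, Int.coe_castAddHom, Int.cast_sum, Int.cast_mul, Pi.smul_apply]
      refine Finset.sum_congr rfl fun j _ => ?_
      have := hg (i, j)
      simp at this
      rw [this]
      simp only [smul_eq_mul, Int.cast_mul]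
      ring
    rw [h, matMap_apply, Matrix.mulVec_mulVec, Matrix.mul_nonsing_inv _ hC, Matrix.one_mulVec]
  have hfin : Finite ((Fin n → ℤ) ⧸ N) := by
    have : Module.Finite ℤ ((Fin n → ℤ) ⧸ N) :=
      Module.Finite.of_surjective (QuotientAddGroup.mk' N).toIntLinearMap
        (QuotientAddGroup.mk'_surjective N)
    refine Module.finite_of_fg_torsion _ ?_
    intro x
    obtain ⟨v, rfl⟩ := QuotientAddGroup.mk'_surjective N x
    refine ⟨c, ?_⟩
    have : (c : ℤ) • (QuotientAddGroup.mk' N v) = 0 := by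
      rw [← map_zsmul]
      exact (QuotientAddGroup.eq_zero_iff _).2 (hmem v)
    exact this
  exact AddSubgroup.index_ne_zero_of_finite

theorem exists_mem_filt (hC : IsUnit C.det) {y : Fin n → ℚ} (hy : y ∈ laurentModule C) :
    ∃ k : ℤ, y ∈ filt C k := by
  refine AddSubgroup.iSup_induction _ (C := fun y => ∃ k : ℤ, y ∈ filt C k) hy ?_ ?_ ?_
  · intro k x hx
    exact ⟨k, AddSubgroup.map_mono intVectors_le hx⟩
  · exact ⟨0, zero_mem _⟩
  · rintro x y ⟨j, hj⟩ ⟨k, hk⟩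
    exact ⟨min j k, add_mem (filt_antitone hC (min_le_left _ _) hj)
      (filt_antitone hC (min_le_right _ _) hk)⟩

theorem one_le_residueCard (hC : IsUnit C.det) : (1 : ℝ) ≤ residueCard C := by
  exact_mod_cast Nat.one_le_iff_ne_zero.2 (residueCard_ne_zero hC)

theorem adicVal_eq (hC : IsUnit C.det) {y : Fin n → ℚ} {k : ℤ} (h1 : y ∈ filt C k)
    (h2 : y ∉ filt C (k + 1)) : adicVal C y = k := by
  have h : {k : ℤ | y ∈ filt C k ∧ y ∉ filt C (k + 1)} = {k} := by
    ext j
    simp only [Set.mem_ofPred_eq, Set.mem_singleton_iff]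
    refine ⟨fun ⟨h3, h4⟩ => ?_, fun h => h ▸ ⟨h1, h2⟩⟩
    by_contra hne
    rcases lt_or_gt_of_ne hne with h | h
    · exact h4 (filt_antitone hC (by omega) h1)
    · exact h2 (filt_antitone hC (by omega) h3)
  rw [adicVal, if_pos ⟨k, h1, h2⟩, h, csInf_singleton]

theorem adicAbs_eq (hC : IsUnit C.det) {y : Fin n → ℚ} {k : ℤ} (h1 : y ∈ filt C k)
    (h2 : y ∉ filt C (k + 1)) : adicAbs C y = (residueCard C : ℝ) ^ (-k) := by
  rw [adicAbs, adicVal_eq hC h1 h2]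
  rfl

theorem adicAbs_eq_zero {y : Fin n → ℚ} (h : ∀ k, y ∈ filt C k) : adicAbs C y = 0 := by
  rw [adicAbs, adicVal, if_neg]
  · rfl
  · rintro ⟨k, -, h2⟩
    exact h2 (h _)

theorem exists_level (hC : IsUnit C.det) {y : Fin n → ℚ} {j k : ℤ} (hj : y ∈ filt C j)
    (hk : y ∉ filt C k) : ∃ m, m < k ∧ y ∈ filt C m ∧ y ∉ filt C (m + 1) := by
  by_contra! hcon
  have h : ∀ i : ℕ, j + i ≤ k → y ∈ filt C (j + i) := by
    intro i
    induction i with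
    | zero => intro _; simpa using hj
    | succ i ih =>
      intro h
      have := hcon (j + i) (by push_cast at h; omega) (ih (by push_cast at h; omega))
      convert this using 2
      push_cast
      ring
  rcases le_total j k with h1 | h1
  · have := h (k - j).toNat (by omega)
    apply hk
    convert this using 2
    omega
  · exact hk (filt_antitone hC h1 hj)

theorem adicAbs_cases (hC : IsUnit C.det) {y : Fin n → ℚ} (hy : y ∈ laurentModule C) :
    ((∀ k, y ∈ filt C k) ∧ adicAbs C y = 0) ∨
      ∃ k, y ∈ filt C k ∧ y ∉ filt C (k + 1) ∧ adicAbs C y = (residueCard C : ℝ) ^ (-k) := by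
  by_cases h : ∀ k, y ∈ filt C k
  · exact Or.inl ⟨h, adicAbs_eq_zero h⟩
  · push Not at h
    obtain ⟨k, hk⟩ := h
    obtain ⟨j, hj⟩ := exists_mem_filt hC hy
    obtain ⟨m, -, h1, h2⟩ := exists_level hC hj hk
    exact Or.inr ⟨m, h1, h2, adicAbs_eq hC h1 h2⟩

theorem adicAbs_le_of_mem (hC : IsUnit C.det) {y : Fin n → ℚ} {k : ℤ} (h : y ∈ filt C k) :
    adicAbs C y ≤ (residueCard C : ℝ) ^ (-k) := by
  have hb := one_le_residueCard hC
  by_cases h' : ∀ j, y ∈ filt C j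
  · rw [adicAbs_eq_zero h']
    positivity
  · push Not at h'
    obtain ⟨j, hj⟩ := h'
    obtain ⟨m, -, h1, h2⟩ := exists_level hC h hj
    rw [adicAbs_eq hC h1 h2]
    refine zpow_le_zpow_right₀ hb ?_
    by_contra hlt
    exact h2 (filt_antitone hC (by omega) h)

theorem adicAbs_nonneg (y : Fin n → ℚ) : 0 ≤ adicAbs C y := by
  rw [adicAbs]
  induction adicVal C y using WithTop.recTopCoe with
  | top => simp
  | coe k => simp only [WithTop.recTopCoe_coe]; positivity

theorem adicAbs_neg (y : Fin n → ℚ) : adicAbs C (-y) = adicAbs C y := by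
  have h : adicVal C (-y) = adicVal C y := by
    have hs : ∀ k : ℤ, (-y ∈ filt C k ∧ -y ∉ filt C (k + 1)) ↔
        (y ∈ filt C k ∧ y ∉ filt C (k + 1)) := fun k => by simp only [neg_mem_iff]
    unfold adicVal
    by_cases h : ∃ k : ℤ, y ∈ filt C k ∧ y ∉ filt C (k + 1)
    · rw [if_pos h, if_pos ((exists_congr hs).2 h)]
      simp only [hs]
    · rw [if_neg h, if_neg (fun h' => h ((exists_congr hs).1 h'))]
  rw [adicAbs, adicAbs, h]

theorem adicAbs_add (hC : IsUnit C.det) {x y : Fin n → ℚ} (hx : x ∈ laurentModule C)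
    (hy : y ∈ laurentModule C) : adicAbs C (x + y) ≤ max (adicAbs C x) (adicAbs C y) := by
  rcases adicAbs_cases hC hx with ⟨h1, e1⟩ | ⟨j, h1, -, e1⟩ <;>
    rcases adicAbs_cases hC hy with ⟨h2, e2⟩ | ⟨k, h2, -, e2⟩ <;> rw [e1, e2]
  · rw [adicAbs_eq_zero fun k => add_mem (h1 k) (h2 k)]
    simp
  · exact le_max_of_le_right (adicAbs_le_of_mem hC (add_mem (h1 k) h2))
  · exact le_max_of_le_left (adicAbs_le_of_mem hC (add_mem h1 (h2 j)))
  · rcases le_total j k with h | h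
    · exact le_max_of_le_left (adicAbs_le_of_mem hC (add_mem h1 (filt_antitone hC h h2)))
    · exact le_max_of_le_right (adicAbs_le_of_mem hC (add_mem (filt_antitone hC h h1) h2))

theorem adicAbs_matMap_inv (hC : IsUnit C.det) (y : Fin n → ℚ) (hy : y ∈ laurentModule C) :
    adicAbs C (matMap C⁻¹ y) = residueCard C * adicAbs C y := by
  have hb : (residueCard C : ℝ) ≠ 0 := by exact_mod_cast residueCard_ne_zero hC
  have key : ∀ k : ℤ, matMap C⁻¹ y ∈ filt C k ↔ y ∈ filt C (k + 1) := by
    intro k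
    rw [← map_filt_one hC k]
    have e : matMap C (matMap C⁻¹ y) = y := by
      simp [matMap_apply, Matrix.mulVec_mulVec, Matrix.mul_nonsing_inv _ hC]
    conv_rhs => rw [← e]
    exact (AddSubgroup.mem_map_iff_mem (matMap_injective hC)).symm
  rcases adicAbs_cases hC hy with ⟨h, e⟩ | ⟨k, h1, h2, e⟩
  · rw [e, adicAbs_eq_zero fun k => (key k).2 (h _), mul_zero]
  · have h1' : matMap C⁻¹ y ∈ filt C (k - 1) := (key _).2 (by simpa using h1)
    have h2' : matMap C⁻¹ y ∉ filt C (k - 1 + 1) := fun h => h2 (by simpa using (key _).1 h)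
    rw [e, adicAbs_eq hC h1' h2', neg_sub, sub_eq_add_neg, zpow_add₀ hb, zpow_one]

theorem matMap_inv_mem (hC : IsUnit C.det) {y : Fin n → ℚ} (hy : y ∈ laurentModule C) :
    matMap C⁻¹ y ∈ laurentModule C := by
  have h : (laurentModule C).map (matMap C⁻¹) ≤ laurentModule C := by
    rw [laurentModule, AddSubgroup.map_iSup]
    refine iSup_le fun k => ?_
    rw [AddSubgroup.map_map, matMap_comp]
    have : C⁻¹ * C ^ k = C ^ (-1 + k) := by rw [Matrix.zpow_add hC, Matrix.zpow_neg_one]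
    rw [this]
    exact le_iSup (fun k : ℤ => (intVectors n).map (matMap (C ^ k))) (-1 + k)
  exact h ⟨y, hy, rfl⟩

theorem polyModule_inv_le (hC : IsUnit C.det) : polyModule C⁻¹ ≤ laurentModule C := by
  refine iSup_le fun k => ?_
  have : C⁻¹ ^ k = C ^ (-(k : ℤ)) := by rw [Matrix.zpow_neg hC, zpow_natCast, Matrix.inv_pow']
  rw [this]
  exact le_iSup (fun k : ℤ => (intVectors n).map (matMap (C ^ k))) _

theorem filt_le_laurent (hC : IsUnit C.det) (k : ℤ) : filt C k ≤ laurentModule C := by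
  rw [filt, polyModule, AddSubgroup.map_iSup]
  refine iSup_le fun j => ?_
  rw [AddSubgroup.map_map, matMap_comp, ← zpow_natCast, ← Matrix.zpow_add hC]
  exact le_iSup (fun k : ℤ => (intVectors n).map (matMap (C ^ k))) _

theorem relIndex_filt_ne_zero (hC : IsUnit C.det) (k : ℕ) :
    (filt C k).relIndex (filt C 0) ≠ 0 := by
  induction k with
  | zero => simp
  | succ k ih =>
    rw [← AddSubgroup.relIndex_mul_relIndex (filt C ((k + 1 : ℕ) : ℤ)) (filt C k) (filt C 0)
      (filt_antitone hC (by push_cast; omega)) (filt_antitone hC (by omega))]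
    refine mul_ne_zero ?_ ih
    push_cast
    rw [relIndex_filt_succ hC]
    exact residueCard_ne_zero hC

end facts

/-! ### The space of `B`-adic series, `B = A⁻¹` -/

/-- The group `ℤⁿ(B)`, `B = A⁻¹`; as a type of its own, since its metric is not the one
inherited from `ℚⁿ`. -/
def LaurentGroup (A : ExpandingMatrix n) : Type := laurentModule (A.1⁻¹)

instance (A : ExpandingMatrix n) : AddCommGroup (LaurentGroup A) :=
  inferInstanceAs (AddCommGroup (laurentModule (A.1⁻¹)))

/-- The inclusion `ℤⁿ(B) → ℚⁿ`. -/
def LaurentGroup.val (A : ExpandingMatrix n) : LaurentGroup A →+ (Fin n → ℚ) :=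
  (laurentModule (A.1⁻¹)).subtype

/-- The (pseudo)metric `d_B(y, y') = b ^ (-ν(y - y'))` on `ℤⁿ(B)`. -/
instance (A : ExpandingMatrix n) : SeminormedAddCommGroup (LaurentGroup A) :=
  AddGroupSeminorm.toSeminormedAddCommGroup
    { toFun := fun y => adicAbs (A.1⁻¹) (LaurentGroup.val A y)
      map_zero' := by
        rw [map_zero]
        exact adicAbs_eq_zero fun k => zero_mem _
      add_le' := fun x y => by
        rw [map_add]
        exact (adicAbs_add (isUnit_det_inv A) x.2 y.2).trans
          (max_le_add_of_nonneg (adicAbs_nonneg _) (adicAbs_nonneg _))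
      neg' := fun y => by rw [map_neg, adicAbs_neg] }

theorem LaurentGroup.norm_def (A : ExpandingMatrix n) (y : LaurentGroup A) :
    ‖y‖ = adicAbs (A.1⁻¹) (LaurentGroup.val A y) := rfl

theorem LaurentGroup.dist_def (A : ExpandingMatrix n) (y y' : LaurentGroup A) :
    dist y y' = adicAbs (A.1⁻¹) (LaurentGroup.val A y - LaurentGroup.val A y') := by
  rw [dist_eq_norm, LaurentGroup.norm_def, map_sub]

/-- Multiplication by `A` on `ℤⁿ(B)`. -/
def LaurentGroup.mulA (A : ExpandingMatrix n) : LaurentGroup A →+ LaurentGroup A :=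
  ((matMap A.1).comp (laurentModule (A.1⁻¹)).subtype).codRestrict (laurentModule (A.1⁻¹))
    fun y => by
      have h := matMap_inv_mem (isUnit_det_inv A) y.2
      rwa [Matrix.nonsing_inv_nonsing_inv _ (isUnit_det A)] at h

theorem LaurentGroup.continuous_mulA (A : ExpandingMatrix n) :
    Continuous (LaurentGroup.mulA A) := by
  refine AddMonoidHomClass.continuous_of_bound (LaurentGroup.mulA A)
    (residueCard (A.1⁻¹)) fun y => ?_
  have h := adicAbs_matMap_inv (isUnit_det_inv A) _ y.2
  rw [Matrix.nonsing_inv_nonsing_inv _ (isUnit_det A)] at h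
  exact h.le

/-- The space `ℤⁿ((B))` of `B`-adic series: the completion of `ℤⁿ(B)` with respect to `d_B`. -/
abbrev AdicSpace (A : ExpandingMatrix n) : Type := Completion (LaurentGroup A)

instance (A : ExpandingMatrix n) : MeasurableSpace (AdicSpace A) := borel _

instance (A : ExpandingMatrix n) : BorelSpace (AdicSpace A) := ⟨rfl⟩

/-- Multiplication by `A` on `ℤⁿ((B))`, the continuous extension of that on `ℤⁿ(B)`. -/
def AdicSpace.mulA (A : ExpandingMatrix n) : AdicSpace A →+ AdicSpace A :=
  (LaurentGroup.mulA A).completion (LaurentGroup.continuous_mulA A)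

theorem LaurentGroup.norm_lt_two (A : ExpandingMatrix n) {y : LaurentGroup A} (h : ‖y‖ < 2) :
    LaurentGroup.val A y ∈ filt (A.1⁻¹) 0 := by
  have hC := isUnit_det_inv A
  by_contra h0
  obtain ⟨j, hj⟩ := exists_mem_filt hC y.2
  obtain ⟨m, hm, h1, h2⟩ := exists_level hC hj h0
  rw [LaurentGroup.norm_def] at h
  have h1' : LaurentGroup.val A y ∈ filt (A.1⁻¹) m := h1
  rw [adicAbs_eq hC h1' h2] at h
  have hb : residueCard (A.1⁻¹) ≠ 1 := by
    intro hb
    rw [← relIndex_filt_succ hC m, AddSubgroup.relIndex_eq_one] at hb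
    exact h2 (hb h1)
  have hb2 : (2 : ℝ) ≤ residueCard (A.1⁻¹) := by
    have := residueCard_ne_zero hC
    exact_mod_cast (by omega : 2 ≤ residueCard (A.1⁻¹))
  have : (residueCard (A.1⁻¹) : ℝ) ^ (1 : ℤ) ≤ (residueCard (A.1⁻¹) : ℝ) ^ (-m) :=
    zpow_le_zpow_right₀ (by linarith) (by omega)
  rw [zpow_one] at this
  linarith

theorem LaurentGroup.totallyBounded (A : ExpandingMatrix n) :
    TotallyBounded {y : LaurentGroup A | LaurentGroup.val A y ∈ filt (A.1⁻¹) 0} := by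
  have hC := isUnit_det_inv A
  rw [Metric.totallyBounded_iff]
  intro ε hε
  obtain ⟨k, hk⟩ : ∃ k : ℕ, ∀ y : LaurentGroup A,
      LaurentGroup.val A y ∈ filt (A.1⁻¹) k → ‖y‖ < ε := by
    rcases eq_or_ne (residueCard (A.1⁻¹)) 1 with hb | hb
    · refine ⟨0, fun y _ => ?_⟩
      rw [LaurentGroup.norm_def]
      rcases adicAbs_cases hC y.2 with ⟨-, e⟩ | ⟨k, h1, h2, -⟩
      · exact lt_of_eq_of_lt e hε
      · rw [← relIndex_filt_succ hC k, AddSubgroup.relIndex_eq_one] at hb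
        exact absurd (hb h1) h2
    · have hb2 : (1 : ℝ) < residueCard (A.1⁻¹) := by
        have := residueCard_ne_zero hC
        exact_mod_cast (by omega : 1 < residueCard (A.1⁻¹))
      obtain ⟨k, hk⟩ := exists_pow_lt_of_lt_one hε (inv_lt_one_of_one_lt₀ hb2)
      refine ⟨k, fun y hy => ?_⟩
      refine (adicAbs_le_of_mem hC hy).trans_lt ?_
      rwa [zpow_neg, zpow_natCast, ← inv_pow]
  have hfin : Finite (filt (A.1⁻¹) 0 ⧸ (filt (A.1⁻¹) k).addSubgroupOf (filt (A.1⁻¹) 0)) :=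
    @AddSubgroup.finite_quotient_of_finiteIndex _ _ _ ⟨relIndex_filt_ne_zero hC k⟩
  let f : (filt (A.1⁻¹) 0 ⧸ (filt (A.1⁻¹) k).addSubgroupOf (filt (A.1⁻¹) 0)) →
      LaurentGroup A := fun q => ⟨q.out.1, filt_le_laurent hC 0 q.out.2⟩
  refine ⟨Set.range f, Set.finite_range f, fun y hy => ?_⟩
  let y' : filt (A.1⁻¹) 0 := ⟨LaurentGroup.val A y, hy⟩
  simp only [Set.mem_iUnion]
  refine ⟨f (QuotientAddGroup.mk y'), ⟨_, rfl⟩, ?_⟩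
  rw [Metric.mem_ball, dist_comm, dist_eq_norm, ← norm_neg, neg_sub, sub_eq_neg_add]
  apply hk
  have h := QuotientAddGroup.eq.1 (QuotientAddGroup.out_eq' (QuotientAddGroup.mk y' :
    filt (A.1⁻¹) 0 ⧸ (filt (A.1⁻¹) k).addSubgroupOf (filt (A.1⁻¹) 0)))
  exact h

theorem AdicSpace.isCompact_closedBall (A : ExpandingMatrix n) :
    IsCompact (Metric.closedBall (0 : AdicSpace A) 1) := by
  have h1 : TotallyBounded (closure ((fun y : LaurentGroup A => (y : AdicSpace A)) ''
      {y : LaurentGroup A | LaurentGroup.val A y ∈ filt (A.1⁻¹) 0})) :=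
    ((LaurentGroup.totallyBounded A).image (Completion.uniformContinuous_coe _)).closure
  refine (h1.subset ?_).isCompact_of_isClosed Metric.isClosed_closedBall
  intro x hx
  rw [mem_closedBall_zero_iff] at hx
  rw [Metric.mem_closure_iff]
  intro ε hε
  obtain ⟨z, ⟨y, rfl⟩, hz⟩ := Metric.mem_closure_iff.1
    (Completion.denseRange_coe (α := LaurentGroup A) x) (min ε 1) (by positivity)
  refine ⟨_, ⟨y, ?_, rfl⟩, hz.trans_le (min_le_left _ _)⟩
  apply LaurentGroup.norm_lt_two
  rw [← Completion.norm_coe]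
  have h2 : ‖(y : AdicSpace A)‖ ≤ ‖x‖ + dist x (y : AdicSpace A) := by
    have h := dist_triangle_left (y : AdicSpace A) 0 x
    rw [dist_zero_right, dist_zero_right, add_comm] at h
    exact h
  have h3 := hz.trans_le (min_le_right _ _)
  linarith

/-- `ℤⁿ[[B]] = {y | ν(y) ≥ 0}`, the closed unit ball of `ℤⁿ((B))`, as a compact set with nonempty
interior. -/
def AdicSpace.unitBall (A : ExpandingMatrix n) :
    TopologicalSpace.PositiveCompacts (AdicSpace A) where
  carrier := Metric.closedBall 0 1
  isCompact' := AdicSpace.isCompact_closedBall A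
  interior_nonempty' :=
    ⟨0, interior_mono Metric.ball_subset_closedBall
      (by rw [Metric.isOpen_ball.interior_eq]; exact Metric.mem_ball_self one_pos)⟩

/-- The Haar measure `μ_B` on `ℤⁿ((B))` normalized by `μ_B(ℤⁿ[[B]]) = 1`. -/
def AdicSpace.haar (A : ExpandingMatrix n) : Measure (AdicSpace A) :=
  Measure.addHaarMeasure (AdicSpace.unitBall A)

/-! ### The representation space and rational self-affine tiles -/

/-- The representation space `𝕂_A = ℝⁿ × ℤⁿ((B))`, with the maximum metric. -/
abbrev RepSpace (A : ExpandingMatrix n) : Type := EuclideanSpace ℝ (Fin n) × AdicSpace A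

/-- The measure `μ = λ × μ_B` on `𝕂_A`. -/
def RepSpace.measure (A : ExpandingMatrix n) : Measure (RepSpace A) :=
  (volume : Measure (EuclideanSpace ℝ (Fin n))).prod (AdicSpace.haar A)

/-- Multiplication by `A` on `𝕂_A`. -/
def RepSpace.mulA (A : ExpandingMatrix n) (z : RepSpace A) : RepSpace A :=
  (WithLp.toLp 2 ((A.1.map (algebraMap ℚ ℝ)).mulVec (WithLp.ofLp z.1)), AdicSpace.mulA A z.2)

/-- The diagonal embedding `φ(x) = (x, x)` of `ℤⁿ(B)` into `𝕂_A`. -/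
def diagonal (A : ExpandingMatrix n) (x : LaurentGroup A) : RepSpace A :=
  (WithLp.toLp 2 fun i => (LaurentGroup.val A x i : ℝ), (x : AdicSpace A))

/-- The inclusion `ℤⁿ[A] → ℤⁿ(B)`. -/
def polyToLaurent (A : ExpandingMatrix n) : polyModule A.1 →+ LaurentGroup A :=
  AddSubgroup.inclusion (by
    have h := polyModule_inv_le (isUnit_det_inv A)
    rwa [Matrix.nonsing_inv_nonsing_inv _ (isUnit_det A)] at h)

/-- `(A, D)` is a digit system: the digit set `D ⊆ ℤⁿ[A]` has as many elements as
`ℤⁿ[A] / A ℤⁿ[A]`. -/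
def IsDigitSystem (A : ExpandingMatrix n) (D : Finset (polyModule A.1)) : Prop :=
  D.card = residueCard A.1

/-- `F` is a nonempty compact solution of the set equation `A F = ⋃_{d ∈ D} (F + φ(d))`. -/
structure IsSelfAffine (A : ExpandingMatrix n) (D : Finset (polyModule A.1))
    (F : Set (RepSpace A)) : Prop where
  nonempty : F.Nonempty
  isCompact : IsCompact F
  setEquation : RepSpace.mulA A '' F =
    ⋃ d ∈ D, (fun z => z + diagonal A (polyToLaurent A d)) '' F

end RationalTile

end

/-
Multiplication by `A` is an expanding automorphism `T` of `𝕂_A`, so `F ↦ T⁻¹ (D + F)` has an iterate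
contracting the Hausdorff distance, which gives existence and uniqueness of the tile. Iterating the
set equation, `T^k F` is a union of at most `|D|^k` translates of `F` by points of the lattice
`Λ = φ(ℤⁿ[A])`.

If `μ F > 0`, then `T^k` blows up a neighbourhood of a density point of `F` to a fixed ball which is
filled by translates of `F` by points of `Λ` up to a small proportion. After moving back by a point
of `Λ`, only a fixed finite set of translates is involved, so in the limit these finitely many
closed translates cover a ball. Hence `F` has interior.

If `F` has interior, some translate of `F` lies in the interior of `T^k F`, so `∂(T^k F)` is covered
by at most `|D|^k - 1` translates of `∂F`. But `T^k` multiplies the measure by at least `|D|^k`,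
because `T` multiplies it by at least `[Λ : TΛ] = |ℤⁿ[A] / A ℤⁿ[A]|`. Hence `μ (∂F) = 0`.
-/

noncomputable section

namespace RationalTile

open Filter MeasureTheory Set Topology UniformSpace
open scoped ENNReal NNReal Pointwise

section SelfAffineSets

variable {K : Type*} [NormedAddCommGroup K] {T : K ≃ₜ+ K} {D F G : Set K}

/-- An automorphism is expanding if the iterates of its inverse tend to `0` uniformly on bounded
sets, at a rate proportional to the norm. -/
def IsExpansion (T : K ≃ₜ+ K) : Prop :=
  ∀ c : ℝ, 0 < c → ∀ᶠ k : ℕ in atTop, ∀ x, ‖T.symm^[k] x‖ ≤ c * ‖x‖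

/-- The sums `T^(k-1) d₁ + ⋯ + T d₍ₖ₋₁₎ + dₖ` of digits `dᵢ ∈ D`, that is, the `k`-digit integers
of the number system with base `T`. -/
def iteratedDigits (T : K ≃ₜ+ K) (D : Set K) : ℕ → Set K
  | 0 => 0
  | k + 1 => T '' iteratedDigits T D k + D

theorem symm_iterate_leftInverse (T : K ≃ₜ+ K) (k : ℕ) : Function.LeftInverse T.symm^[k] T^[k] :=
  Function.LeftInverse.iterate T.symm_apply_apply k

theorem symm_iterate_rightInverse (T : K ≃ₜ+ K) (k : ℕ) : Function.RightInverse T.symm^[k] T^[k] :=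
  Function.RightInverse.iterate T.apply_symm_apply k

theorem isHomeomorph_iterate (T : K ≃ₜ+ K) (k : ℕ) : IsHomeomorph T^[k] := by
  induction k with
  | zero => exact IsHomeomorph.id
  | succ k ih => exact ih.comp T.toHomeomorph.isHomeomorph

theorem image_iterate_subset (hF : T '' F ⊆ D + F) (k : ℕ) :
    T^[k] '' F ⊆ iteratedDigits T D k + F := by
  induction k with
  | zero => simp [iteratedDigits]
  | succ k ih =>
    rw [Function.iterate_succ', image_comp, iteratedDigits, add_assoc]
    exact (image_mono ih).trans (image_add T |>.trans_subset (add_subset_add_left hF))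

theorem subset_image_iterate (hF : D + F ⊆ T '' F) (k : ℕ) :
    iteratedDigits T D k + F ⊆ T^[k] '' F := by
  induction k with
  | zero => simp [iteratedDigits]
  | succ k ih =>
    rw [Function.iterate_succ', image_comp, iteratedDigits, add_assoc]
    exact (add_subset_add_left hF).trans ((image_add T).symm.trans_subset (image_mono ih))

theorem image_iterate_eq (hF : T '' F = D + F) (k : ℕ) :
    T^[k] '' F = iteratedDigits T D k + F :=
  (image_iterate_subset hF.subset k).antisymm (subset_image_iterate hF.superset k)

theorem IsExpansion.tendsto_zero (hT : IsExpansion T) {x : ℕ → K} {R : ℝ} (hx : ∀ k, ‖x k‖ ≤ R) :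
    Tendsto (fun k => T.symm^[k] (x k)) atTop (𝓝 0) := by
  rw [NormedAddGroup.tendsto_nhds_zero]
  intro ε hε
  have hR : 0 < |R| + 1 := by positivity
  filter_upwards [hT (ε / (|R| + 1)) (by positivity)] with k hk
  calc ‖T.symm^[k] (x k)‖ ≤ ε / (|R| + 1) * ‖x k‖ := hk _
    _ ≤ ε / (|R| + 1) * |R| := by gcongr; exact (hx k).trans (le_abs_self R)
    _ < ε / (|R| + 1) * (|R| + 1) := by gcongr; exact lt_add_one _
    _ = ε := div_mul_cancel₀ ε hR.ne'

theorem IsExpansion.subset_of_isClosed (hT : IsExpansion T) (hFb : Bornology.IsBounded F)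
    (hF : T '' F ⊆ D + F) (hGc : IsClosed G) (hGn : G.Nonempty) (hG : D + G ⊆ T '' G) :
    F ⊆ G := by
  intro f hf
  obtain ⟨g, hg⟩ := hGn
  obtain ⟨R, hR⟩ := hFb.exists_norm_le
  have hcode (k : ℕ) : ∃ h ∈ G, ∃ f' ∈ F, f - h = T.symm^[k] (f' - g) := by
    obtain ⟨d, hd, f', hf', hdf⟩ := image_iterate_subset hF k (mem_image_of_mem _ hf)
    obtain ⟨h, hh, hdg⟩ := subset_image_iterate hG k (add_mem_add hd hg)
    refine ⟨h, hh, f', hf', ?_⟩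
    rw [← symm_iterate_leftInverse T k (f - h), iterate_map_sub, ← hdf, hdg]
    simp
  choose h hh f' hf' hfh using hcode
  refine hGc.mem_of_tendsto (f := h) (b := atTop) ?_ (Eventually.of_forall hh)
  have hzero : Tendsto (fun k => f - h k) atTop (𝓝 0) := by
    simp only [hfh]
    exact hT.tendsto_zero fun k => (norm_sub_le _ _).trans (add_le_add_left (hR _ (hf' k)) _)
  simpa using hzero.const_sub f

theorem IsExpansion.eq_of_isCompact (hT : IsExpansion T) (hFc : IsCompact F) (hFn : F.Nonempty)
    (hF : T '' F = D + F) (hGc : IsCompact G) (hGn : G.Nonempty) (hG : T '' G = D + G) : F = G :=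
  (hT.subset_of_isClosed hFc.isBounded hF.subset hGc.isClosed hGn hG.superset).antisymm
    (hT.subset_of_isClosed hGc.isBounded hG.subset hFc.isClosed hFn hF.superset)

theorem IsExpansion.eq_closure_interior (hT : IsExpansion T) (hFc : IsCompact F)
    (hF : T '' F = D + F) (hint : (interior F).Nonempty) : F = closure (interior F) := by
  refine (hT.subset_of_isClosed hFc.isBounded hF.subset isClosed_closure hint.closure ?_).antisymm
    (closure_minimal interior_subset hFc.isClosed)
  have hTc : T '' closure (interior F) = closure (interior (D + F)) := by
    rw [← hF]
    exact (T.toHomeomorph.image_closure _).trans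
      (congrArg closure (T.toHomeomorph.image_interior F))
  rw [hTc]
  rintro - ⟨d, hd, x, hx, rfl⟩
  refine map_mem_closure (f := (d + ·)) (by fun_prop) hx fun y hy => ?_
  have hvadd : d +ᵥ interior F ⊆ interior (D + F) := by
    rw [← interior_vadd]
    exact interior_mono (vadd_set_subset_add hd)
  exact hvadd (vadd_mem_vadd_set hy)

theorem IsExpansion.exists_vadd_subset_interior (hT : IsExpansion T)
    (hFb : Bornology.IsBounded F) (hF : T '' F = D + F) (hint : (interior F).Nonempty) :
    ∃ k, ∃ d ∈ iteratedDigits T D k, d +ᵥ F ⊆ interior (T^[k] '' F) := by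
  obtain ⟨x, hx⟩ := hint
  obtain ⟨ε, hε, hball⟩ := Metric.isOpen_iff.1 isOpen_interior x hx
  obtain ⟨R, hR⟩ := hFb.exists_norm_le
  have hR0 : 0 ≤ R := (norm_nonneg x).trans (hR x (interior_subset hx))
  obtain ⟨k, hk⟩ := (hT (ε / (2 * R + 1)) (by positivity)).exists
  obtain ⟨d, hd, f, hf, hdf⟩ :=
    (image_iterate_eq hF k).subset (mem_image_of_mem _ (interior_subset hx))
  refine ⟨k, d, hd, ?_⟩
  rw [← (isHomeomorph_iterate T k).image_interior]
  rintro - ⟨g, hg, rfl⟩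
  refine ⟨x + T.symm^[k] (g - f), hball ?_, ?_⟩
  · rw [mem_ball_iff_norm, add_sub_cancel_left]
    calc ‖T.symm^[k] (g - f)‖ ≤ ε / (2 * R + 1) * ‖g - f‖ := hk _
      _ ≤ ε / (2 * R + 1) * (2 * R) := by
          gcongr
          linarith [norm_sub_le g f, hR g hg, hR f hf]
      _ < ε / (2 * R + 1) * (2 * R + 1) := by gcongr; exact lt_add_one _
      _ = ε := div_mul_cancel₀ ε (by positivity)
  · change _ = d + g
    rw [iterate_map_add, symm_iterate_rightInverse, ← show d + f = T^[k] x from hdf,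
      add_add_sub_cancel]

section Existence

open TopologicalSpace

/-- The Hutchinson operator `F ↦ T⁻¹ (D + F)`, whose fixed points are the self-affine sets. -/
def hutchinson (T : K ≃ₜ+ K) (D : NonemptyCompacts K) (F : NonemptyCompacts K) :
    NonemptyCompacts K where
  carrier := T.symm '' (D + F)
  isCompact' := (D.isCompact.add F.isCompact).image T.symm.continuous
  nonempty' := (D.nonempty.add F.nonempty).image _

theorem image_hutchinson (T : K ≃ₜ+ K) (D F : NonemptyCompacts K) :
    T '' (hutchinson T D F : Set K) = D + F :=
  T.toEquiv.image_symm_image _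

theorem image_iterate_hutchinson (T : K ≃ₜ+ K) (D F : NonemptyCompacts K) (k : ℕ) :
    T^[k] '' ((hutchinson T D)^[k] F : Set K) = iteratedDigits T (D : Set K) k + F := by
  induction k generalizing F with
  | zero => simp [iteratedDigits]
  | succ k ih =>
    rw [Function.iterate_succ', image_comp, Function.iterate_succ_apply, ih, image_add T,
      image_hutchinson, iteratedDigits, add_assoc]

theorem dist_iterate_hutchinson_le (D F G : NonemptyCompacts K) {c : ℝ} (hc : 0 ≤ c) {k : ℕ}
    (hk : ∀ x, ‖T.symm^[k] x‖ ≤ c * ‖x‖) :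
    dist ((hutchinson T D)^[k] F) ((hutchinson T D)^[k] G) ≤ c * dist F G := by
  have hmem (F G : NonemptyCompacts K) : ∀ x ∈ (hutchinson T D)^[k] F,
      ∃ y ∈ (hutchinson T D)^[k] G, dist x y ≤ c * dist F G := by
    intro x hx
    obtain ⟨d, hd, f, hf, hdf⟩ :=
      (image_iterate_hutchinson T D F k).subset (mem_image_of_mem _ hx)
    obtain ⟨g, hg, hfg⟩ := G.isCompact.exists_infDist_eq_dist G.nonempty f
    obtain ⟨y, hy, hdg⟩ := (image_iterate_hutchinson T D G k).superset (add_mem_add hd hg)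
    refine ⟨y, hy, ?_⟩
    calc dist x y = ‖T.symm^[k] (T^[k] (x - y))‖ := by
          rw [symm_iterate_leftInverse, dist_eq_norm]
      _ = ‖T.symm^[k] (f - g)‖ := by rw [iterate_map_sub, ← hdf, hdg]; simp
      _ ≤ c * dist f g := (hk _).trans_eq (by rw [dist_eq_norm])
      _ ≤ c * dist F G := by
          gcongr
          rw [← hfg, Metric.NonemptyCompacts.dist_eq]
          exact Metric.infDist_le_hausdorffDist_of_mem hf
            (Metric.hausdorffEDist_ne_top_of_nonempty_of_bounded F.nonempty G.nonempty
              F.isCompact.isBounded G.isCompact.isBounded)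
  refine Metric.hausdorffDist_le_of_mem_dist (by positivity) (hmem F G) fun x hx => ?_
  rw [dist_comm F G]
  exact hmem G F x hx

theorem IsExpansion.exists_isCompact [CompleteSpace K] (hT : IsExpansion T) (hDc : IsCompact D)
    (hDn : D.Nonempty) : ∃ F : Set K, F.Nonempty ∧ IsCompact F ∧ T '' F = D + F := by
  let D' : NonemptyCompacts K := ⟨⟨D, hDc⟩, hDn⟩
  have : Nonempty (NonemptyCompacts K) := ⟨D'⟩
  obtain ⟨k, hk⟩ := (hT (1 / 2) (by norm_num)).exists
  have hcontr : ContractingWith (1 / 2) (hutchinson T D')^[k] :=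
    ⟨by norm_num, LipschitzWith.of_dist_le_mul fun F G =>
      dist_iterate_hutchinson_le D' F G (by positivity) (by simpa using hk)⟩
  have hfix := hcontr.isFixedPt_fixedPoint_iterate
  set F := hcontr.fixedPoint
  refine ⟨F, F.nonempty, F.isCompact, ?_⟩
  calc T '' F = T '' (hutchinson T D' F) := by rw [hfix.eq]
    _ = D + F := image_hutchinson T D' F

end Existence

end SelfAffineSets

section LatticeDigits

variable {K : Type*} [NormedAddCommGroup K] {T : K ≃ₜ+ K} {D : Set K} {Λ : AddSubgroup K}

theorem finite_iteratedDigits (hD : D.Finite) (k : ℕ) : (iteratedDigits T D k).Finite := by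
  induction k with
  | zero => exact finite_zero
  | succ k ih => exact (ih.image T).add hD

theorem ncard_iteratedDigits_le (T : K ≃ₜ+ K) (D : Set K) (k : ℕ) :
    (iteratedDigits T D k).ncard ≤ D.ncard ^ k := by
  induction k with
  | zero => exact (ncard_singleton 0).le
  | succ k ih =>
    calc (T '' iteratedDigits T D k + D).ncard
        ≤ (T '' iteratedDigits T D k).ncard * D.ncard := natCard_add_le
      _ ≤ D.ncard ^ k * D.ncard := by
          rw [ncard_image_of_injective _ T.injective]
          gcongr
      _ = D.ncard ^ (k + 1) := (pow_succ _ k).symm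

theorem iteratedDigits_subset (hΛ : Λ.map (T : K →+ K) ≤ Λ) (hD : D ⊆ Λ) (k : ℕ) :
    iteratedDigits T D k ⊆ Λ := by
  induction k with
  | zero => simp [iteratedDigits]
  | succ k ih =>
    rintro - ⟨-, ⟨x, hx, rfl⟩, d, hd, rfl⟩
    exact Λ.add_mem (hΛ ⟨x, ih hx, rfl⟩) (hD hd)

theorem exists_forall_add_iterate_mem_add {F : Set K} (hF : T '' F = D + F)
    (hΛT : Λ.map (T : K →+ K) ≤ Λ) (hD : D ⊆ Λ) {R : ℝ} (hR : ∀ x ∈ F, ‖x‖ ≤ R) (ρ : ℝ) (k : ℕ)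
    {f : K} (hf : f ∈ F) :
    ∃ g ∈ F, ∀ w, f + w ∈ F → ‖T^[k] w‖ ≤ ρ →
      g + T^[k] w ∈ ((Λ : Set K) ∩ Metric.closedBall 0 (R + ρ + R)) + F := by
  have hDk := iteratedDigits_subset hΛT hD k
  obtain ⟨d, hd, g, hg, hdg⟩ := (image_iterate_eq hF k).subset (mem_image_of_mem _ hf)
  refine ⟨g, hg, fun w hfw hw => ?_⟩
  obtain ⟨d', hd', g', hg', hdg'⟩ := (image_iterate_eq hF k).subset (mem_image_of_mem _ hfw)
  have heq : d' - d = g + T^[k] w - g' := by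
    have hsum : d' + g' = d + g + T^[k] w := by
      rwa [iterate_map_add, ← hdg] at hdg'
    rw [eq_sub_of_add_eq hsum]
    abel
  refine ⟨d' - d, ⟨Λ.sub_mem (hDk hd') (hDk hd), mem_closedBall_zero_iff.2 ?_⟩, g', hg', ?_⟩
  · rw [heq]
    linarith [norm_sub_le (g + T^[k] w) g', norm_add_le g (T^[k] w), hR g hg, hR g' hg']
  · change d' - d + g' = _
    rw [heq, sub_add_cancel]

theorem coe_map_iterate (T : K ≃ₜ+ K) (Λ : AddSubgroup K) (k : ℕ) :
    ((AddSubgroup.map (T : K →+ K))^[k] Λ : Set K) = T^[k] '' Λ := by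
  induction k with
  | zero => simp
  | succ k ih =>
    rw [Function.iterate_succ_apply', Function.iterate_succ', image_comp, AddSubgroup.coe_map, ih]
    rfl

theorem map_iterate_le {G : Type*} [AddGroup G] {f : G →+ G} {H : AddSubgroup G}
    (hH : H.map f ≤ H) (k : ℕ) : (AddSubgroup.map f)^[k] H ≤ H := by
  induction k with
  | zero => exact le_rfl
  | succ k ih =>
    rw [Function.iterate_succ_apply']
    exact (AddSubgroup.map_mono ih).trans hH

theorem relIndex_map_iterate {G : Type*} [AddGroup G] {f : G →+ G} (hf : Function.Injective f)
    {H : AddSubgroup G} (hH : H.map f ≤ H) (k : ℕ) :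
    ((AddSubgroup.map f)^[k] H).relIndex H = (H.map f).relIndex H ^ k := by
  induction k with
  | zero => simp
  | succ k ih =>
    rw [Function.iterate_succ_apply', ← AddSubgroup.relIndex_mul_relIndex _ _ _
        (AddSubgroup.map_mono (map_iterate_le hH k)) hH,
      AddSubgroup.relIndex_map_map_of_injective _ _ hf, ih, pow_succ]

theorem exists_subset_inter_ncard_eq_relIndex {G : Type*} [AddCommGroup G] {H L : AddSubgroup G}
    (hHL : H ≤ L) {E : Set G} (hE : (L : Set G) ⊆ H + E) :
    ∃ S : Set G, S ⊆ L ∩ E ∧ S.ncard = H.relIndex L := by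
  have hrep (q : L ⧸ H.addSubgroupOf L) : ∃ x : L, (x : G) ∈ E ∧
      (x : L ⧸ H.addSubgroupOf L) = q := by
    obtain ⟨y, rfl⟩ := QuotientAddGroup.mk_surjective q
    obtain ⟨h, hh, e, he, hy⟩ := hE y.2
    have heq : e = y - h := eq_sub_of_add_eq' hy
    refine ⟨⟨e, heq ▸ L.sub_mem y.2 (hHL hh)⟩, he, ?_⟩
    rw [QuotientAddGroup.eq, AddSubgroup.mem_addSubgroupOf]
    simpa [heq] using hh
  choose s hsE hs using hrep
  refine ⟨range fun q => (s q : G), ?_, ncard_range_of_injective ?_⟩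
  · rintro - ⟨q, rfl⟩
    exact ⟨(s q).2, hsE q⟩
  · exact Subtype.val_injective.comp (Function.LeftInverse.injective hs)

theorem exists_pairwiseDisjoint_vadd_ball
    (hΛ : ∀ R, ((Λ : Set K) ∩ Metric.closedBall 0 R).Finite) :
    ∃ r > 0, (Λ : Set K).PairwiseDisjoint (· +ᵥ Metric.ball (0 : K) r) := by
  have hnhds : (((Λ : Set K) ∩ Metric.closedBall 0 1) \ {0})ᶜ ∈ 𝓝 0 :=
    ((hΛ 1).subset sdiff_subset).isClosed.isOpen_compl.mem_nhds (by simp)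
  obtain ⟨r, hr, hball⟩ := Metric.mem_nhds_iff.1 hnhds
  refine ⟨min r 1 / 2, by positivity, fun x hx y hy hxy => ?_⟩
  rw [Function.onFun, disjoint_left]
  rintro - ⟨u, hu, rfl⟩ ⟨v, hv, huv⟩
  have hnorm : ‖x - y‖ < min r 1 := by
    have hsub : x - y = v - u := by
      rw [sub_eq_sub_iff_add_eq_add, add_comm v]
      exact huv.symm
    rw [mem_ball_zero_iff] at hu hv
    exact hsub ▸ (norm_sub_le v u).trans_lt (by linarith)
  rw [lt_min_iff] at hnorm
  exact hball (mem_ball_zero_iff.2 hnorm.1)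
    ⟨⟨Λ.sub_mem hx hy, mem_closedBall_zero_iff.2 hnorm.2.le⟩, sub_ne_zero.2 hxy⟩

theorem le_of_eventually_pow_mul_le {a c M m : ℝ≥0} (ha : 0 < a)
    (h : ∀ᶠ k : ℕ in atTop, m ^ k * a ≤ c ^ k * M) : m ≤ c := by
  by_contra! hcm
  have hm : 0 < m := hcm.bot_lt
  have hlim : Tendsto (fun k : ℕ => (c / m) ^ k * M) atTop (𝓝 0) := by
    simpa using (NNReal.tendsto_pow_atTop_nhds_zero_of_lt_one
      ((div_lt_one hm).2 hcm)).mul_const M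
  refine ha.not_ge (ge_of_tendsto hlim (h.mono fun k hk => ?_))
  rw [div_pow, div_mul_eq_mul_div, le_div_iff₀ (by positivity), mul_comm]
  exact hk

end LatticeDigits

section Translates

theorem frontier_add_subset {G : Type*} [TopologicalSpace G] [AddGroup G] [ContinuousConstVAdd G G]
    {S F : Set G} (hSF : IsClosed (S + F)) {d : G} (hd : d +ᵥ F ⊆ interior (S + F)) :
    frontier (S + F) ⊆ (S \ {d}) + frontier F := by
  rw [hSF.frontier_eq]
  rintro - ⟨⟨s, hs, f, hf, rfl⟩, hsf⟩
  refine ⟨s, ⟨hs, ?_⟩, f, ⟨subset_closure hf, fun hf' => hsf ?_⟩, rfl⟩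
  · rintro rfl
    exact hsf (hd (vadd_mem_vadd_set hf))
  · refine interior_mono (vadd_set_subset_add hs) ?_
    rw [interior_vadd]
    exact vadd_mem_vadd_set hf'

theorem interior_nonempty_of_finite_add {G : Type*} [TopologicalSpace G] [AddGroup G]
    [ContinuousConstVAdd G G] {S F : Set G} (hS : S.Finite) (hF : IsClosed F)
    (h : (interior (S + F)).Nonempty) : (interior F).Nonempty := by
  contrapose! h
  induction S, hS using Set.Finite.induction_on with
  | empty => simp
  | @insert s S _ _ ih =>
    have hs : {s} + F = s +ᵥ F := singleton_vadd
    rw [insert_eq, union_add, hs, interior_union_isClosed_of_interior_empty (hF.vadd s) ih,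
      interior_vadd, h, vadd_set_empty]

theorem measure_add_le {G : Type*} [AddGroup G] [MeasurableSpace G] (μ : Measure G)
    [μ.IsAddLeftInvariant] {S : Set G} (hS : S.Finite) (X : Set G) :
    μ (S + X) ≤ S.ncard * μ X := by
  calc μ (S + X) = μ (⋃ s ∈ hS.toFinset, s +ᵥ X) := by simp [iUnion_vadd_set]
    _ ≤ ∑ s ∈ hS.toFinset, μ (s +ᵥ X) := measure_biUnion_finset_le _ _
    _ = S.ncard * μ X := by simp [measure_vadd, ncard_eq_toFinset_card S hS]

theorem measure_add_eq {G : Type*} [AddGroup G] [MeasurableSpace G] [MeasurableAdd G]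
    (μ : Measure G) [μ.IsAddLeftInvariant] {S X : Set G} (hS : S.Finite) (hX : MeasurableSet X)
    (hdisj : S.PairwiseDisjoint (· +ᵥ X)) : μ (S + X) = S.ncard * μ X := by
  calc μ (S + X) = μ (⋃ s ∈ hS.toFinset, s +ᵥ X) := by simp [iUnion_vadd_set]
    _ = ∑ s ∈ hS.toFinset, μ (s +ᵥ X) :=
        measure_biUnion_finset (by simpa using hdisj) fun s _ => hX.const_vadd s
    _ = S.ncard * μ X := by simp [measure_vadd, ncard_eq_toFinset_card S hS]

theorem setLIntegral_measure_inter_add_mem_comm {G : Type*} [AddGroup G] [MeasurableSpace G]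
    [MeasurableAdd₂ G] (μ : Measure G) [SFinite μ] (E W : Set G) {S : Set G}
    (hS : MeasurableSet S) :
    ∫⁻ x in E, μ ({v | x + v ∈ S} ∩ W) ∂μ = ∫⁻ v in W, μ ({x | x + v ∈ S} ∩ E) ∂μ := by
  have hadd : MeasurableSet {p : G × G | p.1 + p.2 ∈ S} := measurable_add hS
  have h := (Measure.prod_apply (μ := μ.restrict E) (ν := μ.restrict W) hadd).symm.trans
    (Measure.prod_apply_symm hadd)
  simp only [Measure.restrict_apply (measurable_prodMk_left hadd),
    Measure.restrict_apply (measurable_prodMk_right hadd)] at h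
  exact h

theorem forall_add_mem_of_tendsto_measure {G : Type*} [TopologicalSpace G] [Add G] [ContinuousAdd G]
    [MeasurableSpace G] (μ : Measure G) [μ.IsOpenPosMeasure] {B C : Set G} (hB : IsOpen B)
    (hC : IsClosed C) {f : ℕ → G} {g : G} (hf : Tendsto f atTop (𝓝 g))
    (h0 : Tendsto (fun m => μ ({v | f m + v ∈ Cᶜ} ∩ B)) atTop (𝓝 0)) :
    ∀ v ∈ B, g + v ∈ C := by
  intro v hv
  by_contra hgv
  have hnhds : ∀ᶠ p : G × G in 𝓝 (g, v), p.1 + p.2 ∈ Cᶜ ∧ p.2 ∈ B :=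
    ((hC.isOpen_compl.preimage continuous_add).inter
      (hB.preimage continuous_snd)).mem_nhds ⟨hgv, hv⟩
  rw [nhds_prod_eq, eventually_prod_iff] at hnhds
  obtain ⟨p, hp, q, hq, hpq⟩ := hnhds
  refine (Measure.measure_pos_of_mem_nhds μ hq).not_ge (ge_of_tendsto h0 ?_)
  filter_upwards [hf.eventually hp] with m hm
  exact measure_mono fun w hw => hpq hm hw

end Translates

section Measure

variable {K : Type*} [NormedAddCommGroup K] [LocallyCompactSpace K] [SecondCountableTopology K]
  [MeasurableSpace K] [BorelSpace K] (μ : Measure K) [μ.IsAddHaarMeasure] {T : K ≃ₜ+ K}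
  {D F : Set K} {Λ : AddSubgroup K}

theorem measure_image_iterate (T : K ≃ₜ+ K) (E : Set K) (k : ℕ) :
    μ (T^[k] '' E) = addEquivAddHaarChar T ^ k * μ E := by
  induction k with
  | zero => simp
  | succ k ih =>
    rw [Function.iterate_succ', image_comp, ← addEquivAddHaarChar_smul_preimage μ T,
      preimage_image_eq _ T.injective, ih, pow_succ', mul_assoc]
    rfl

theorem pow_relIndex_mul_measure_ball_le (hΛT : Λ.map (T : K →+ K) ≤ Λ)
    (hΛ : ∀ R, ((Λ : Set K) ∩ Metric.closedBall 0 R).Finite) {E : Set K} (hE : IsCompact E)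
    (hΛE : (Λ : Set K) + E = univ) {r : ℝ}
    (hdisj : (Λ : Set K).PairwiseDisjoint (· +ᵥ Metric.ball (0 : K) r)) {k : ℕ}
    (hk : ∀ x, ‖T.symm^[k] x‖ ≤ ‖x‖) :
    ((Λ.map (T : K →+ K)).relIndex Λ : ℝ≥0∞) ^ k * μ (Metric.ball 0 r)
      ≤ addEquivAddHaarChar T ^ k * μ (E + Metric.ball 0 r) := by
  have hcover : (Λ : Set K) ⊆ (AddSubgroup.map (T : K →+ K))^[k] Λ + T^[k] '' E := by
    intro x _
    obtain ⟨l, hl, e, he, hle⟩ := hΛE.superset (mem_univ (T.symm^[k] x))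
    rw [coe_map_iterate]
    refine ⟨T^[k] l, mem_image_of_mem _ hl, T^[k] e, mem_image_of_mem _ he, ?_⟩
    rw [← symm_iterate_rightInverse T k x, ← hle, iterate_map_add]
  have hle : (AddSubgroup.map (T : K →+ K))^[k] Λ ≤ Λ := map_iterate_le hΛT k
  obtain ⟨S, hS, hcard⟩ := exists_subset_inter_ncard_eq_relIndex hle hcover
  rw [relIndex_map_iterate T.injective hΛT] at hcard
  obtain ⟨R, hR⟩ := (hE.image (isHomeomorph_iterate T k).continuous)
    |>.isBounded.subset_closedBall 0
  have hSfin : S.Finite := (hΛ R).subset fun x hx => ⟨(hS hx).1, hR (hS hx).2⟩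
  have hball : Metric.ball (0 : K) r ⊆ T^[k] '' Metric.ball 0 r := fun x hx =>
    ⟨T.symm^[k] x, mem_ball_zero_iff.2 ((hk x).trans_lt (mem_ball_zero_iff.1 hx)),
      symm_iterate_rightInverse T k x⟩
  calc ((Λ.map (T : K →+ K)).relIndex Λ : ℝ≥0∞) ^ k * μ (Metric.ball 0 r)
      = μ (S + Metric.ball 0 r) := by
        rw [measure_add_eq μ hSfin Metric.isOpen_ball.measurableSet
          (hdisj.subset fun x hx => (hS hx).1), hcard, Nat.cast_pow]
    _ ≤ μ (T^[k] '' (E + Metric.ball 0 r)) := by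
        refine measure_mono ((add_subset_add (fun x hx => (hS hx).2) hball).trans_eq ?_)
        exact (image_image2_distrib (iterate_map_add T k)).symm
    _ = addEquivAddHaarChar T ^ k * μ (E + Metric.ball 0 r) := measure_image_iterate μ T _ k

/- Packing: every coset of `T^k Λ` in `Λ` meets `T^k E`, and balls of a fixed small radius around
the points of `Λ` are disjoint. -/
theorem IsExpansion.relIndex_le_addEquivAddHaarChar (hT : IsExpansion T)
    (hΛT : Λ.map (T : K →+ K) ≤ Λ) (hΛ : ∀ R, ((Λ : Set K) ∩ Metric.closedBall 0 R).Finite)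
    {E : Set K} (hE : IsCompact E) (hΛE : (Λ : Set K) + E = univ) :
    ((Λ.map (T : K →+ K)).relIndex Λ : ℝ≥0) ≤ addEquivAddHaarChar T := by
  obtain ⟨r, hr, hdisj⟩ := exists_pairwiseDisjoint_vadd_ball hΛ
  obtain ⟨ρ, hρ, hcompact⟩ := Metric.exists_isCompact_closedBall (0 : K)
  let μ : Measure K := Measure.addHaar
  set X := Metric.ball (0 : K) (min r ρ)
  have hXr : X ⊆ Metric.ball 0 r := Metric.ball_subset_ball (min_le_left _ _)
  have hXρ : X ⊆ Metric.closedBall 0 ρ :=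
    (Metric.ball_subset_ball (min_le_right _ _)).trans Metric.ball_subset_closedBall
  have hX0 : μ X ≠ 0 := (Metric.measure_ball_pos μ _ (by positivity)).ne'
  have hX : μ X ≠ ∞ := ((measure_mono hXρ).trans_lt hcompact.measure_lt_top).ne
  have hEX : μ (E + X) ≠ ∞ :=
    ((measure_mono (add_subset_add_left hXρ)).trans_lt (hE.add hcompact).measure_lt_top).ne
  refine le_of_eventually_pow_mul_le (ENNReal.toNNReal_pos hX0 hX)
    ((hT 1 one_pos).mono fun k hk => ?_) (M := (μ (E + X)).toNNReal)
  rw [← ENNReal.coe_le_coe]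
  push_cast
  rw [ENNReal.coe_toNNReal hX, ENNReal.coe_toNNReal hEX]
  exact pow_relIndex_mul_measure_ball_le μ hΛT hΛ hE hΛE
    (hdisj.mono fun x => vadd_set_mono hXr) (by simpa using hk)

theorem IsExpansion.measure_frontier_eq_zero (hT : IsExpansion T) (hFc : IsCompact F)
    (hF : T '' F = D + F) (hD : D.Finite) (hDT : (D.ncard : ℝ≥0) ≤ addEquivAddHaarChar T)
    (hint : (interior F).Nonempty) : μ (frontier F) = 0 := by
  obtain ⟨k, d, hd, hdF⟩ := hT.exists_vadd_subset_interior hFc.isBounded hF hint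
  have hhomeo := isHomeomorph_iterate T k
  have hclosed : IsClosed (T^[k] '' F) := hhomeo.isClosedMap F hFc.isClosed
  have himage : T^[k] '' frontier F ⊆ (iteratedDigits T D k \ {d}) + frontier F := by
    refine (hhomeo.image_frontier F).trans_subset ?_
    rw [image_iterate_eq hF] at hclosed hdF ⊢
    exact frontier_add_subset hclosed hdF
  have hfin := finite_iteratedDigits (T := T) hD k
  have hcard : (iteratedDigits T D k \ {d}).ncard < D.ncard ^ k :=
    (ncard_sdiff_singleton_lt_of_mem hd hfin).trans_le (ncard_iteratedDigits_le T D k)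
  have htop : μ (frontier F) ≠ ∞ :=
    ((measure_mono hFc.isClosed.frontier_subset).trans_lt hFc.measure_lt_top).ne
  have hle : (D.ncard : ℝ≥0∞) ^ k * μ (frontier F)
      ≤ (iteratedDigits T D k \ {d}).ncard * μ (frontier F) :=
    calc (D.ncard : ℝ≥0∞) ^ k * μ (frontier F)
        ≤ addEquivAddHaarChar T ^ k * μ (frontier F) := by gcongr; exact_mod_cast hDT
      _ = μ (T^[k] '' frontier F) := (measure_image_iterate μ T _ k).symm
      _ ≤ (iteratedDigits T D k \ {d}).ncard * μ (frontier F) :=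
          (measure_mono himage).trans (measure_add_le μ (hfin.subset sdiff_subset) _)
  by_contra h0
  exact hle.not_gt (ENNReal.mul_lt_mul_left h0 htop (by exact_mod_cast hcard))

theorem exists_measure_add_notMem_le (hFc : IsCompact F) (hF0 : μ F ≠ 0) {ε : ℝ≥0∞} (hε : ε ≠ 0) :
    ∃ U ∈ 𝓝 (0 : K), ∀ W ⊆ U, MeasurableSet W →
      ∃ f ∈ F, μ ({v | f + v ∈ Fᶜ} ∩ W) ≤ ε * μ W := by
  have hFm := hFc.isClosed.measurableSet
  have hFtop : μ F ≠ ∞ := hFc.measure_lt_top.ne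
  have hnhds : ∀ᶠ v in 𝓝 (0 : K), μ ((v +ᵥ F) \ F) < ε * μ F :=
    eventually_nhds_zero_measure_vadd_sdiff_lt hFc hFc.isClosed (mul_ne_zero hε hF0)
  refine ⟨_, hnhds, fun W hW hWm => ?_⟩
  have hadd : MeasurableSet {p : K × K | p.1 + p.2 ∈ Fᶜ} := measurable_add hFm.compl
  have hmeas : Measurable fun x => μ ({v | x + v ∈ Fᶜ} ∩ W) :=
    measurable_measure_prodMk_left (hadd.inter (measurable_snd hWm))
  have htranslate : ∀ v ∈ W, μ ({x | x + v ∈ Fᶜ} ∩ F) ≤ ε * μ F := fun v hv => by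
    calc μ ({x | x + v ∈ Fᶜ} ∩ F) = μ (v +ᵥ ({x | x + v ∈ Fᶜ} ∩ F)) := (measure_vadd μ v _).symm
      _ ≤ μ ((v +ᵥ F) \ F) := by
          refine measure_mono ?_
          rintro - ⟨x, ⟨hxv, hx⟩, rfl⟩
          exact ⟨vadd_mem_vadd_set hx, by simpa [add_comm] using hxv⟩
      _ ≤ ε * μ F := (hW hv).le
  obtain ⟨f, hf, hle⟩ := exists_le_setLAverage hF0 hFtop hmeas.aemeasurable
  refine ⟨f, hf, hle.trans ?_⟩
  rw [setLAverage_eq, setLIntegral_measure_inter_add_mem_comm μ F W hFm.compl]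
  refine ENNReal.div_le_of_le_mul ?_
  calc ∫⁻ v in W, μ ({x | x + v ∈ Fᶜ} ∩ F) ∂μ ≤ ∫⁻ _ in W, ε * μ F ∂μ :=
        setLIntegral_mono' hWm htranslate
    _ = ε * μ W * μ F := by rw [setLIntegral_const]; ring

/- Lebesgue density: `F` nearly fills some tiny copy of a ball, which is blown up by `T^k`. -/
theorem IsExpansion.exists_measure_add_notMem_translates_le (hT : IsExpansion T) (hFc : IsCompact F)
    (hF : T '' F = D + F) (hΛT : Λ.map (T : K →+ K) ≤ Λ) (hD : D ⊆ Λ) (hF0 : μ F ≠ 0) {R : ℝ}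
    (hR : ∀ x ∈ F, ‖x‖ ≤ R) (ρ : ℝ) {ε : ℝ≥0∞} (hε : ε ≠ 0) :
    ∃ g ∈ F, μ ({v | g + v ∈ (((Λ : Set K) ∩ Metric.closedBall 0 (R + ρ + R)) + F)ᶜ}
      ∩ Metric.ball 0 ρ) ≤ ε * μ (Metric.ball (0 : K) ρ) := by
  obtain ⟨U, hU, hdense⟩ := exists_measure_add_notMem_le μ hFc hF0 hε
  obtain ⟨δ, hδ, hδU⟩ := Metric.mem_nhds_iff.1 hU
  obtain ⟨k, hk⟩ := (hT (δ / (|ρ| + 1)) (by positivity)).exists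
  set W : Set K := T^[k] ⁻¹' Metric.ball 0 ρ
  have hWU : W ⊆ U := fun w hw => hδU <| mem_ball_zero_iff.2 <| by
    calc ‖w‖ = ‖T.symm^[k] (T^[k] w)‖ := by rw [symm_iterate_leftInverse]
      _ ≤ δ / (|ρ| + 1) * ‖T^[k] w‖ := hk _
      _ < δ / (|ρ| + 1) * (|ρ| + 1) := by
          gcongr
          linarith [mem_ball_zero_iff.1 hw, le_abs_self ρ]
      _ = δ := div_mul_cancel₀ δ (by positivity)
  have hWm : MeasurableSet W :=
    (Metric.isOpen_ball.preimage (isHomeomorph_iterate T k).continuous).measurableSet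
  have hWimage : T^[k] '' W = Metric.ball 0 ρ :=
    image_preimage_eq _ (isHomeomorph_iterate T k).surjective
  obtain ⟨f, hf, hfle⟩ := hdense W hWU hWm
  obtain ⟨g, hg, hgF⟩ := exists_forall_add_iterate_mem_add hF hΛT hD hR ρ k hf
  refine ⟨g, hg, ?_⟩
  have hsub : {v | g + v ∈ (((Λ : Set K) ∩ Metric.closedBall 0 (R + ρ + R)) + F)ᶜ}
      ∩ Metric.ball 0 ρ ⊆ T^[k] '' ({v | f + v ∈ Fᶜ} ∩ W) := by
    rintro v ⟨hgv, hv⟩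
    obtain ⟨w, hw, rfl⟩ := hWimage.superset hv
    exact ⟨w, ⟨fun hfw => hgv (hgF w hfw (mem_ball_zero_iff.1 hv).le), hw⟩, rfl⟩
  calc _ ≤ μ (T^[k] '' ({v | f + v ∈ Fᶜ} ∩ W)) := measure_mono hsub
    _ = addEquivAddHaarChar T ^ k * μ ({v | f + v ∈ Fᶜ} ∩ W) := measure_image_iterate μ T _ k
    _ ≤ addEquivAddHaarChar T ^ k * (ε * μ W) := by gcongr
    _ = ε * μ (T^[k] '' W) := by rw [measure_image_iterate μ T W k]; ring
    _ = ε * μ (Metric.ball 0 ρ) := by rw [hWimage]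

theorem IsExpansion.interior_nonempty_of_measure_ne_zero (hT : IsExpansion T) (hFc : IsCompact F)
    (hF : T '' F = D + F) (hΛT : Λ.map (T : K →+ K) ≤ Λ)
    (hΛ : ∀ R, ((Λ : Set K) ∩ Metric.closedBall 0 R).Finite) (hD : D ⊆ Λ) (hF0 : μ F ≠ 0) :
    (interior F).Nonempty := by
  obtain ⟨ρ, hρ, hcompact⟩ := Metric.exists_isCompact_closedBall (0 : K)
  obtain ⟨R, hR⟩ := hFc.isBounded.exists_norm_le
  have hB : μ (Metric.ball 0 ρ) ≠ ∞ :=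
    ((measure_mono Metric.ball_subset_closedBall).trans_lt hcompact.measure_lt_top).ne
  choose f hf hfle using fun m : ℕ => hT.exists_measure_add_notMem_translates_le μ hFc hF hΛT hD hF0
    hR ρ (ENNReal.inv_ne_zero.2 (ENNReal.natCast_ne_top m))
  obtain ⟨g, -, φ, hφ, hfg⟩ := hFc.tendsto_subseq hf
  have hlim : Tendsto (fun m => ((φ m : ℕ) : ℝ≥0∞)⁻¹ * μ (Metric.ball (0 : K) ρ)) atTop (𝓝 0) := by
    simpa using ENNReal.Tendsto.mul_const
      (ENNReal.tendsto_inv_nat_nhds_zero.comp hφ.tendsto_atTop) (Or.inr hB)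
  have hclosed : IsClosed (((Λ : Set K) ∩ Metric.closedBall 0 (R + ρ + R)) + F) :=
    ((hΛ _).isCompact.add hFc).isClosed
  have hball : g +ᵥ Metric.ball (0 : K) ρ ⊆
      ((Λ : Set K) ∩ Metric.closedBall 0 (R + ρ + R)) + F := by
    rintro - ⟨v, hv, rfl⟩
    exact forall_add_mem_of_tendsto_measure μ Metric.isOpen_ball hclosed hfg
      (tendsto_of_tendsto_of_tendsto_of_le_of_le tendsto_const_nhds hlim (fun _ => zero_le)
        fun m => hfle (φ m)) v hv
  exact interior_nonempty_of_finite_add (hΛ (R + ρ + R)) hFc.isClosed ⟨g,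
    interior_maximal hball (Metric.isOpen_ball.vadd g) ⟨0, Metric.mem_ball_self hρ, add_zero g⟩⟩

theorem IsExpansion.tfae_measure_pos_interior (hT : IsExpansion T) (hFc : IsCompact F)
    (hFn : F.Nonempty) (hF : T '' F = D + F) (hΛT : Λ.map (T : K →+ K) ≤ Λ)
    (hΛ : ∀ R, ((Λ : Set K) ∩ Metric.closedBall 0 R).Finite) (hDfin : D.Finite) (hD : D ⊆ Λ)
    (hDT : (D.ncard : ℝ≥0) ≤ addEquivAddHaarChar T) :
    List.TFAE [0 < μ F, (interior F).Nonempty, F = closure (interior F) ∧ μ (frontier F) = 0] := by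
  tfae_have 1 → 2 := fun h =>
    hT.interior_nonempty_of_measure_ne_zero μ hFc hF hΛT hΛ hD h.ne'
  tfae_have 2 → 3 := fun h =>
    ⟨hT.eq_closure_interior hFc hF h, hT.measure_frontier_eq_zero μ hFc hF hDfin hDT h⟩
  tfae_have 3 → 1 := fun h =>
    Measure.measure_pos_of_nonempty_interior μ (closure_nonempty_iff.1 (h.1 ▸ hFn))
  tfae_finish

end Measure

section Discreteness

variable {n : ℕ} {C : Matrix (Fin n) (Fin n) ℚ}

/-- The sum of the `C ^ k ℤⁿ` with `k < N`: the part of `ℤⁿ[C]` spanned by the polynomials in `C`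
of degree less than `N`. -/
def truncPolyModule (C : Matrix (Fin n) (Fin n) ℚ) (N : ℕ) : AddSubgroup (Fin n → ℚ) :=
  ⨆ k < N, (intVectors n).map (matMap (C ^ k))

theorem truncPolyModule_zero : truncPolyModule C 0 = ⊥ := by
  simp [truncPolyModule]

theorem truncPolyModule_succ (N : ℕ) :
    truncPolyModule C (N + 1) = truncPolyModule C N ⊔ (intVectors n).map (matMap (C ^ N)) :=
  Nat.iSup_lt_succ (fun k => (intVectors n).map (matMap (C ^ k))) N

theorem truncPolyModule_mono : Monotone (truncPolyModule C) :=
  monotone_nat_of_le_succ fun N => le_sup_left.trans_eq (truncPolyModule_succ N).symm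

theorem polyModule_eq_iSup_truncPolyModule : polyModule C = ⨆ N, truncPolyModule C N := by
  refine le_antisymm (iSup_le fun k => ?_) (iSup_le fun N => iSup₂_le fun k _ => ?_)
  · exact (le_sup_right.trans_eq (truncPolyModule_succ k).symm).trans (le_iSup _ (k + 1))
  · exact le_iSup (fun k => (intVectors n).map (matMap (C ^ k))) k

theorem exists_mem_truncPolyModule {y : Fin n → ℚ} (hy : y ∈ polyModule C) :
    ∃ N, y ∈ truncPolyModule C N := by
  rwa [polyModule_eq_iSup_truncPolyModule,
    AddSubgroup.mem_iSup_of_directed truncPolyModule_mono.directed_le] at hy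

theorem matMap_matMap (C C' : Matrix (Fin n) (Fin n) ℚ) (v : Fin n → ℚ) :
    matMap C (matMap C' v) = matMap (C * C') v :=
  DFunLike.congr_fun (matMap_comp C C') v

theorem map_pow_truncPolyModule_le (m N : ℕ) :
    (truncPolyModule C N).map (matMap (C ^ m)) ≤ truncPolyModule C (m + N) := by
  simp only [truncPolyModule, AddSubgroup.map_iSup, AddSubgroup.map_map, matMap_comp, ← pow_add]
  exact iSup₂_le fun k hk =>
    le_iSup₂ (f := fun k (_ : k < m + N) => (intVectors n).map (matMap (C ^ k))) (m + k) (by omega)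

theorem map_pow_truncPolyModule_inv_le (hC : IsUnit C.det) (m : ℕ) :
    (truncPolyModule C⁻¹ (m + 1)).map (matMap (C ^ m)) ≤ truncPolyModule C (m + 1) := by
  simp only [truncPolyModule, AddSubgroup.map_iSup, AddSubgroup.map_map, matMap_comp]
  refine iSup₂_le fun k hk => ?_
  obtain ⟨j, rfl⟩ := Nat.exists_eq_add_of_le (Nat.lt_succ_iff.1 hk)
  have hpow : C ^ (k + j) * C⁻¹ ^ k = C ^ j := by
    rw [add_comm, pow_add, mul_assoc, Matrix.inv_pow', Matrix.mul_nonsing_inv _ (by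
      rw [Matrix.det_pow]; exact hC.pow k), mul_one]
  rw [hpow]
  exact le_iSup₂ (f := fun i (_ : i < k + j + 1) => (intVectors n).map (matMap (C ^ i))) j
    (by omega)

/- The vectors `u ∈ ℤⁿ` with `C ^ N u ∈ truncPolyModule C N` form an increasing sequence of
subgroups of the Noetherian module `ℤⁿ`. -/
theorem exists_forall_matMap_pow_mem_truncPolyModule (C : Matrix (Fin n) (Fin n) ℚ) :
    ∃ J, ∀ N ≥ J, ∀ m, ∀ u ∈ intVectors n,
      matMap (C ^ (m + N)) u ∈ truncPolyModule C (m + N) →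
        matMap (C ^ N) u ∈ truncPolyModule C N := by
  let E (N : ℕ) : AddSubgroup (Fin n → ℤ) :=
    (truncPolyModule C N).comap ((matMap (C ^ N)).comp (castVec n))
  have hE : Monotone E := monotone_nat_of_le_succ fun N u hu => by
    have h := map_pow_truncPolyModule_le 1 N (AddSubgroup.mem_map_of_mem (matMap (C ^ 1)) hu)
    rwa [AddMonoidHom.comp_apply, matMap_matMap, ← pow_add, add_comm 1] at h
  obtain ⟨J, hJ⟩ := monotone_stabilizes_iff_noetherian.2
    (inferInstance : IsNoetherian ℤ (Fin n → ℤ)) ⟨_, AddSubgroup.toIntSubmodule.monotone.comp hE⟩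
  have hstable : ∀ N ≥ J, E N = E J := fun N hN =>
    AddSubgroup.toIntSubmodule.injective (hJ N hN).symm
  refine ⟨J, fun N hN m u hu hmem => ?_⟩
  obtain ⟨v, rfl⟩ := hu
  have hv : v ∈ E (m + N) := hmem
  rw [hstable (m + N) (by omega), ← hstable N hN] at hv
  exact hv

/- The top coefficient of an element of `ℤⁿ[C] ∩ C ^ k ℤⁿ[C⁻¹]` of large degree can be removed by
the preceding lemma, so the degree descends to a bound depending on `k` only. -/
theorem exists_polyModule_inf_filt_inv_le (hC : IsUnit C.det) (k : ℕ) :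
    ∃ N, polyModule C ⊓ filt C⁻¹ (-k) ≤ truncPolyModule C N := by
  obtain ⟨J, hJ⟩ := exists_forall_matMap_pow_mem_truncPolyModule C
  refine ⟨max J (k + 1), ?_⟩
  rintro y ⟨hyP, q, hq, rfl⟩
  have hpow : C⁻¹ ^ (-k : ℤ) = C ^ k := by
    rw [← Matrix.inv_zpow' (Matrix.isUnit_nonsing_inv_det _ hC),
      Matrix.nonsing_inv_nonsing_inv _ hC, zpow_natCast]
  rw [hpow] at hyP ⊢
  set y := matMap (C ^ k) q with hy
  obtain ⟨m, hm⟩ := exists_mem_truncPolyModule hq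
  have hpow_mem : matMap (C ^ m) y ∈ truncPolyModule C (k + (m + 1)) := by
    rw [hy, matMap_matMap, ← pow_add, add_comm m k, pow_add, ← matMap_matMap]
    refine map_pow_truncPolyModule_le k (m + 1) (AddSubgroup.mem_map_of_mem _ ?_)
    exact map_pow_truncPolyModule_inv_le hC m
      (AddSubgroup.mem_map_of_mem _ (truncPolyModule_mono m.le_succ hm))
  have hdescent : ∀ N ≥ max J (k + 1),
      y ∈ truncPolyModule C (N + 1) → y ∈ truncPolyModule C N := by
    intro N hN hyN
    rw [truncPolyModule_succ] at hyN
    obtain ⟨l, hl, _, ⟨u, hu, rfl⟩, hluy⟩ := AddSubgroup.mem_sup.1 hyN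
    rw [← hluy]
    refine add_mem hl (hJ N (le_of_max_le_left hN) m u hu ?_)
    have hu_eq : matMap (C ^ (m + N)) u = matMap (C ^ m) y - matMap (C ^ m) l := by
      rw [← hluy, map_add, add_sub_cancel_left, matMap_matMap, pow_add]
    rw [hu_eq]
    exact sub_mem (truncPolyModule_mono (by omega) hpow_mem)
      (map_pow_truncPolyModule_le m N (AddSubgroup.mem_map_of_mem _ hl))
  obtain ⟨M, hM⟩ := exists_mem_truncPolyModule hyP
  exact Nat.decreasingInduction' (P := fun N => y ∈ truncPolyModule C N)
    (fun N _ hN => hdescent N hN) (le_max_left _ M) (truncPolyModule_mono (le_max_right _ M) hM)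

theorem den_nsmul_matMap_mem_intVectors (C : Matrix (Fin n) (Fin n) ℚ) {v : Fin n → ℚ}
    (hv : v ∈ intVectors n) : C.den • matMap C v ∈ intVectors n := by
  obtain ⟨u, rfl⟩ := hv
  have hnum : C.num.map (Int.castRingHom ℚ) = C.den • C := by
    ext i j
    have h := (div_eq_iff (Nat.cast_ne_zero.2 C.den_ne_zero)).1 (C.num_div_den i j)
    rwa [mul_comm, ← nsmul_eq_mul] at h
  refine ⟨C.num.mulVec u, ?_⟩
  rw [matMap_apply, ← Matrix.smul_mulVec, ← hnum]
  exact funext fun i => RingHom.map_mulVec (Int.castRingHom ℚ) C.num u i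

theorem exists_nsmul_mem_intVectors (C : Matrix (Fin n) (Fin n) ℚ) (N : ℕ) :
    ∃ c : ℕ, c ≠ 0 ∧ ∀ y ∈ truncPolyModule C N, c • y ∈ intVectors n := by
  induction N with
  | zero => exact ⟨1, one_ne_zero, by simp +contextual [truncPolyModule_zero]⟩
  | succ N ih =>
    obtain ⟨c, hc, hcN⟩ := ih
    refine ⟨c * (C ^ N).den, mul_ne_zero hc (Matrix.den_ne_zero _), fun y hy => ?_⟩
    rw [truncPolyModule_succ] at hy
    obtain ⟨l, hl, _, ⟨u, hu, rfl⟩, rfl⟩ := AddSubgroup.mem_sup.1 hy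
    rw [smul_add]
    refine add_mem ?_ ?_
    · rw [mul_comm, mul_nsmul']
      exact nsmul_mem (hcN l hl) _
    · rw [mul_nsmul']
      exact nsmul_mem (den_nsmul_matMap_mem_intVectors (C ^ N) hu) _

theorem finite_setOf_nsmul_mem_intVectors {c : ℕ} (hc : c ≠ 0) (R : ℝ) :
    {y : Fin n → ℚ | c • y ∈ intVectors n ∧ ∀ i, |(y i : ℝ)| ≤ R}.Finite := by
  refine ((Set.finite_Icc (fun _ : Fin n => -⌈c * R⌉) (fun _ => ⌈c * R⌉)).image
    fun v => (c : ℚ)⁻¹ • castVec n v).subset ?_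
  rintro y ⟨⟨v, hv⟩, hy⟩
  have hv_abs (i : Fin n) : |v i| ≤ ⌈c * R⌉ := by
    have hvi : (v i : ℚ) = c * y i := (congrFun hv i).trans (nsmul_eq_mul c (y i))
    have h : |(v i : ℝ)| ≤ c * R := by
      rw [← Rat.cast_intCast, hvi, Rat.cast_mul, Rat.cast_natCast, abs_mul, Nat.abs_cast]
      exact mul_le_mul_of_nonneg_left (hy i) c.cast_nonneg
    exact_mod_cast h.trans (Int.le_ceil _)
  refine ⟨v, ⟨fun i => (abs_le.1 (hv_abs i)).1, fun i => (abs_le.1 (hv_abs i)).2⟩, ?_⟩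
  change (c : ℚ)⁻¹ • castVec n v = y
  rw [hv, ← Nat.cast_smul_eq_nsmul ℚ, inv_smul_smul₀ (Nat.cast_ne_zero.2 hc)]

end Discreteness

section AdicAbs

variable {n : ℕ} {C : Matrix (Fin n) (Fin n) ℚ}

theorem two_le_residueCard (hC : IsUnit C.det) {y : Fin n → ℚ} {k : ℤ} (hy : y ∈ filt C k)
    (hy' : y ∉ filt C (k + 1)) : 2 ≤ residueCard C := by
  have hne_one : residueCard C ≠ 1 := by
    rw [← relIndex_filt_succ hC k, Ne, AddSubgroup.relIndex_eq_one]
    exact fun hle => hy' (hle hy)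
  have hne_zero := residueCard_ne_zero hC
  omega

theorem two_mul_adicAbs_le (hC : IsUnit C.det) {y : Fin n → ℚ} (hy : y ∈ laurentModule C) :
    2 * adicAbs C y ≤ residueCard C * adicAbs C y := by
  rcases adicAbs_cases hC hy with ⟨-, h⟩ | ⟨k, h₁, h₂, -⟩
  · rw [h, mul_zero, mul_zero]
  · exact mul_le_mul_of_nonneg_right (mod_cast two_le_residueCard hC h₁ h₂) (adicAbs_nonneg y)

theorem mem_filt_of_adicAbs_lt (hC : IsUnit C.det) {y : Fin n → ℚ} (hy : y ∈ laurentModule C)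
    {k : ℕ} (h : adicAbs C y < 2 ^ k) : y ∈ filt C (-k) := by
  by_contra hyk
  obtain ⟨j, hj⟩ := exists_mem_filt hC hy
  obtain ⟨m, hmk, h₁, h₂⟩ := exists_level hC hj hyk
  refine h.not_ge ?_
  calc (2 : ℝ) ^ k ≤ (residueCard C : ℝ) ^ k :=
        pow_le_pow_left₀ zero_le_two (mod_cast two_le_residueCard hC h₁ h₂) k
    _ = (residueCard C : ℝ) ^ (k : ℤ) := (zpow_natCast _ k).symm
    _ ≤ (residueCard C : ℝ) ^ (-m) := zpow_le_zpow_right₀ (one_le_residueCard hC) (by omega)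
    _ = adicAbs C y := (adicAbs_eq hC h₁ h₂).symm

end AdicAbs

section Contraction

theorem tendsto_pow_nhds_zero_of_spectrum {R : Type*} [NormedRing R] [NormedAlgebra ℂ R]
    [CompleteSpace R] (a : R) (ha : ∀ z ∈ spectrum ℂ a, ‖z‖ < 1) :
    Tendsto (fun k : ℕ => a ^ k) atTop (𝓝 0) := by
  rcases subsingleton_or_nontrivial R with hR | hR
  · exact tendsto_const_nhds.congr fun k => Subsingleton.elim 0 (a ^ k)
  have hrad : spectralRadius ℂ a < (1 : ℝ≥0) :=
    spectrum.spectralRadius_lt_of_forall_lt a fun z hz => mod_cast ha z hz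
  obtain ⟨r, har, hr⟩ := ENNReal.lt_iff_exists_nnreal_btwn.1 hrad
  have hgelfand := (spectrum.pow_nnnorm_pow_one_div_tendsto_nhds_spectralRadius a).eventually
    (gt_mem_nhds har)
  refine squeeze_zero_norm' ?_
    (tendsto_pow_atTop_nhds_zero_of_lt_one r.coe_nonneg (mod_cast hr : (r : ℝ) < 1))
  filter_upwards [hgelfand, eventually_gt_atTop 0] with k hk hk0
  rw [one_div, ENNReal.rpow_inv_lt_iff (mod_cast hk0), ENNReal.rpow_natCast] at hk
  exact_mod_cast hk.le

variable {n : ℕ}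

theorem norm_lt_one_of_mem_spectrum_inv (A : ExpandingMatrix n) {z : ℂ}
    (hz : z ∈ spectrum ℂ (A.1⁻¹.map (algebraMap ℚ ℂ))) : ‖z‖ < 1 := by
  let a : (Matrix (Fin n) (Fin n) ℂ)ˣ :=
    Units.map (algebraMap ℚ ℂ).mapMatrix.toMonoidHom (A.1.nonsingInvUnit (isUnit_det A))
  have hz' : z⁻¹ ∈ spectrum ℂ (a : Matrix (Fin n) (Fin n) ℂ) := spectrum.inv₀_mem_iff.2 hz
  have h := A.2 _ hz'
  rw [norm_inv] at h
  exact (one_lt_inv_iff₀.1 h).2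

theorem norm_toEuclideanCLM_le_complex (M : Matrix (Fin n) (Fin n) ℝ) :
    ‖Matrix.toEuclideanCLM (𝕜 := ℝ) M‖ ≤
      ‖Matrix.toEuclideanCLM (𝕜 := ℂ) (M.map (algebraMap ℝ ℂ))‖ := by
  let ι (x : EuclideanSpace ℝ (Fin n)) : EuclideanSpace ℂ (Fin n) :=
    WithLp.toLp 2 fun i => (x i : ℂ)
  have norm_ι (x) : ‖ι x‖ = ‖x‖ := by simp [ι, EuclideanSpace.norm_eq]
  have map_ι (x) : Matrix.toEuclideanCLM (𝕜 := ℂ) (M.map (algebraMap ℝ ℂ)) (ι x) =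
      ι (Matrix.toEuclideanCLM (𝕜 := ℝ) M x) := by
    ext i
    simp [ι, Matrix.ofLp_toEuclideanCLM, Matrix.mulVec, dotProduct]
  refine ContinuousLinearMap.opNorm_le_bound _ (norm_nonneg _) fun x => ?_
  rw [← norm_ι, ← map_ι, ← norm_ι x]
  exact ContinuousLinearMap.le_opNorm _ _

/-- The action of rational matrices on the Euclidean factor `ℝⁿ` of the representation space. -/
def realMul : Matrix (Fin n) (Fin n) ℚ →+*
    (EuclideanSpace ℝ (Fin n) →L[ℝ] EuclideanSpace ℝ (Fin n)) :=
  RingHom.comp (Matrix.toEuclideanCLM (n := Fin n) (𝕜 := ℝ)) (algebraMap ℚ ℝ).mapMatrix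

theorem tendsto_realMul_inv_pow (A : ExpandingMatrix n) :
    Tendsto (fun k : ℕ => realMul A.1⁻¹ ^ k) atTop (𝓝 0) := by
  let a := Matrix.toEuclideanCLM (𝕜 := ℂ) (A.1⁻¹.map (algebraMap ℚ ℂ))
  have ha : Tendsto (fun k : ℕ => a ^ k) atTop (𝓝 0) :=
    tendsto_pow_nhds_zero_of_spectrum a fun z hz =>
      norm_lt_one_of_mem_spectrum_inv A (by rwa [AlgEquiv.spectrum_eq] at hz)
  refine squeeze_zero_norm (fun k => ?_) (tendsto_zero_iff_norm_tendsto_zero.1 ha)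
  have hmap : ((A.1⁻¹ ^ k).map (algebraMap ℚ ℝ)).map (algebraMap ℝ ℂ) =
      A.1⁻¹.map (algebraMap ℚ ℂ) ^ k := by
    rw [← RingHom.mapMatrix_apply (algebraMap ℚ ℂ), ← map_pow]
    ext i j
    simp
  calc ‖realMul A.1⁻¹ ^ k‖ = ‖realMul (A.1⁻¹ ^ k)‖ := by rw [map_pow]
    _ ≤ ‖Matrix.toEuclideanCLM (n := Fin n) (𝕜 := ℂ)
          (((A.1⁻¹ ^ k).map (algebraMap ℚ ℝ)).map (algebraMap ℝ ℂ))‖ :=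
        norm_toEuclideanCLM_le_complex _
    _ = ‖a ^ k‖ := by rw [hmap, map_pow]

end Contraction

section AdicSpace

variable {n : ℕ}

theorem matMap_mem_laurentModule {C : Matrix (Fin n) (Fin n) ℚ} (hC : IsUnit C.det)
    {y : Fin n → ℚ} (hy : y ∈ laurentModule C) : matMap C y ∈ laurentModule C := by
  obtain ⟨j, hj⟩ := exists_mem_filt hC hy
  exact filt_le_laurent hC (j + 1) (map_filt_one hC j ▸ AddSubgroup.mem_map_of_mem _ hj)

variable (A : ExpandingMatrix n)

namespace LaurentGroup

theorem val_injective : Function.Injective (val A) :=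
  Subtype.val_injective

theorem val_mulA (y : LaurentGroup A) : val A (mulA A y) = matMap A.1 (val A y) :=
  rfl

/-- Multiplication by `B = A⁻¹` on `ℤⁿ(B)`. -/
def mulInv : LaurentGroup A →+ LaurentGroup A :=
  (((matMap A.1⁻¹).comp (val A)).codRestrict (laurentModule A.1⁻¹)
    fun y => matMap_mem_laurentModule (isUnit_det_inv A) y.2)

theorem val_mulInv (y : LaurentGroup A) : val A (mulInv A y) = matMap A.1⁻¹ (val A y) :=
  rfl

theorem mulA_mulInv (y : LaurentGroup A) : mulA A (mulInv A y) = y := by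
  apply val_injective
  rw [val_mulA, val_mulInv, matMap_matMap, Matrix.mul_nonsing_inv _ (isUnit_det A), matMap_one,
    AddMonoidHom.id_apply]

theorem mulInv_mulA (y : LaurentGroup A) : mulInv A (mulA A y) = y := by
  apply val_injective
  rw [val_mulInv, val_mulA, matMap_matMap, Matrix.nonsing_inv_mul _ (isUnit_det A), matMap_one,
    AddMonoidHom.id_apply]

theorem norm_mulA (y : LaurentGroup A) : ‖mulA A y‖ = residueCard A.1⁻¹ * ‖y‖ := by
  have h := adicAbs_matMap_inv (isUnit_det_inv A) _ y.2
  rwa [Matrix.nonsing_inv_nonsing_inv _ (isUnit_det A)] at h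

theorem norm_mulInv_le (y : LaurentGroup A) : ‖mulInv A y‖ ≤ 2⁻¹ * ‖y‖ := by
  rw [le_inv_mul_iff₀ two_pos]
  calc 2 * ‖mulInv A y‖ ≤ residueCard A.1⁻¹ * ‖mulInv A y‖ :=
        two_mul_adicAbs_le (isUnit_det_inv A) (mulInv A y).2
    _ = ‖y‖ := by rw [← norm_mulA, mulA_mulInv]

theorem continuous_mulInv : Continuous (mulInv A) :=
  AddMonoidHomClass.continuous_of_bound _ 2⁻¹ (norm_mulInv_le A)

instance : Countable (LaurentGroup A) :=
  inferInstanceAs (Countable (laurentModule A.1⁻¹))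

end LaurentGroup

namespace AdicSpace

theorem continuous_mulA : Continuous (mulA A) :=
  AddMonoidHom.continuous_completion _ _

theorem mulA_coe (y : LaurentGroup A) :
    mulA A (y : AdicSpace A) = (LaurentGroup.mulA A y : AdicSpace A) :=
  AddMonoidHom.completion_coe _ _ _

/-- Multiplication by `B = A⁻¹` on `ℤⁿ((B))`. -/
def mulInv : AdicSpace A →+ AdicSpace A :=
  (LaurentGroup.mulInv A).completion (LaurentGroup.continuous_mulInv A)

theorem continuous_mulInv : Continuous (mulInv A) :=
  AddMonoidHom.continuous_completion _ _

theorem mulInv_coe (y : LaurentGroup A) :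
    mulInv A (y : AdicSpace A) = (LaurentGroup.mulInv A y : AdicSpace A) :=
  AddMonoidHom.completion_coe _ _ _

theorem mulA_mulInv (y : AdicSpace A) : mulA A (mulInv A y) = y := by
  refine Completion.induction_on y
    (isClosed_eq ((continuous_mulA A).comp (continuous_mulInv A)) continuous_id) fun y => ?_
  rw [mulInv_coe, mulA_coe, LaurentGroup.mulA_mulInv]

theorem mulInv_mulA (y : AdicSpace A) : mulInv A (mulA A y) = y := by
  refine Completion.induction_on y
    (isClosed_eq ((continuous_mulInv A).comp (continuous_mulA A)) continuous_id) fun y => ?_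
  rw [mulA_coe, mulInv_coe, LaurentGroup.mulInv_mulA]

theorem norm_mulInv_le (y : AdicSpace A) : ‖mulInv A y‖ ≤ 2⁻¹ * ‖y‖ := by
  refine Completion.induction_on y
    (isClosed_le (continuous_mulInv A).norm (continuous_const.mul continuous_norm)) fun y => ?_
  rw [mulInv_coe, Completion.norm_coe, Completion.norm_coe]
  exact LaurentGroup.norm_mulInv_le A y

theorem norm_mulInv_iterate_le (k : ℕ) (y : AdicSpace A) :
    ‖(mulInv A)^[k] y‖ ≤ (2⁻¹ : ℝ) ^ k * ‖y‖ := by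
  induction k with
  | zero => simp
  | succ k ih =>
    rw [Function.iterate_succ_apply', pow_succ', mul_assoc]
    exact (norm_mulInv_le A _).trans (mul_le_mul_of_nonneg_left ih (by norm_num))

instance : SecondCountableTopology (AdicSpace A) :=
  UniformSpace.secondCountable_of_separable (AdicSpace A)

instance : LocallyCompactSpace (AdicSpace A) :=
  (isCompact_closedBall A).locallyCompactSpace_of_mem_nhds_of_addGroup
    (Metric.closedBall_mem_nhds 0 one_pos)

instance : (haar A).IsAddHaarMeasure :=
  inferInstanceAs (Measure.addHaarMeasure _).IsAddHaarMeasure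

end AdicSpace

namespace RepSpace

instance : (RepSpace.measure A).IsAddHaarMeasure :=
  inferInstanceAs ((volume : Measure (EuclideanSpace ℝ (Fin n))).prod
    (AdicSpace.haar A)).IsAddHaarMeasure

/-- Multiplication by `A` as a topological automorphism of the representation space. -/
def mulEquiv : RepSpace A ≃ₜ+ RepSpace A where
  toFun := mulA A
  invFun := Prod.map (realMul A.1⁻¹) (AdicSpace.mulInv A)
  left_inv z := by
    refine Prod.ext ?_ (AdicSpace.mulInv_mulA A z.2)
    change (realMul A.1⁻¹ * realMul A.1) z.1 = z.1
    rw [← map_mul, Matrix.nonsing_inv_mul _ (isUnit_det A), map_one]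
    rfl
  right_inv z := by
    refine Prod.ext ?_ (AdicSpace.mulA_mulInv A z.2)
    change (realMul A.1 * realMul A.1⁻¹) z.1 = z.1
    rw [← map_mul, Matrix.mul_nonsing_inv _ (isUnit_det A), map_one]
    rfl
  map_add' z w := Prod.ext (map_add (realMul A.1) z.1 w.1) (map_add (AdicSpace.mulA A) z.2 w.2)
  continuous_toFun := (realMul A.1).continuous.prodMap (AdicSpace.continuous_mulA A)
  continuous_invFun := (realMul A.1⁻¹).continuous.prodMap (AdicSpace.continuous_mulInv A)

theorem isExpansion_mulEquiv : IsExpansion (mulEquiv A) := by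
  intro c hc
  have hreal : ∀ᶠ k : ℕ in atTop, ‖realMul A.1⁻¹ ^ k‖ < c :=
    (tendsto_zero_iff_norm_tendsto_zero.1 (tendsto_realMul_inv_pow A)).eventually_lt_const hc
  have hadic : ∀ᶠ k : ℕ in atTop, (2⁻¹ : ℝ) ^ k < c :=
    (tendsto_pow_atTop_nhds_zero_of_lt_one (by norm_num) (by norm_num)).eventually_lt_const hc
  filter_upwards [hreal, hadic] with k hk_real hk_adic z
  change ‖(Prod.map (realMul A.1⁻¹) (AdicSpace.mulInv A))^[k] z‖ ≤ c * ‖z‖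
  rw [Prod.map_iterate, Prod.norm_def]
  refine max_le ?_ ?_
  · rw [Prod.map_fst, ← FunLike.coe_pow_eq_iterate]
    exact (ContinuousLinearMap.le_of_opNorm_le _ hk_real.le _).trans
      (mul_le_mul_of_nonneg_left (norm_fst_le z) hc.le)
  · exact (AdicSpace.norm_mulInv_iterate_le A k z.2).trans
      (mul_le_mul hk_adic.le (norm_snd_le z) (norm_nonneg _) hc.le)

end RepSpace

end AdicSpace

section DiagonalLattice

variable {n : ℕ} (A : ExpandingMatrix n)

/-- The diagonal embedding of `ℤⁿ[A]` into the representation space, whose image is a lattice. -/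
def diagonalHom : polyModule A.1 →+ RepSpace A where
  toFun d := diagonal A (polyToLaurent A d)
  map_zero' := by
    refine Prod.ext ?_ Completion.coe_zero
    ext i
    simp [diagonal]
  map_add' d d' := by
    refine Prod.ext ?_ (Completion.coe_add (polyToLaurent A d) (polyToLaurent A d'))
    ext i
    simp [diagonal]

theorem diagonalHom_fst_apply (d : polyModule A.1) (i : Fin n) :
    (diagonalHom A d).1 i = ((d : Fin n → ℚ) i : ℝ) :=
  rfl

theorem diagonalHom_injective : Function.Injective (diagonalHom A) := by
  intro d d' h
  ext i
  rw [← Rat.cast_inj (α := ℝ), ← diagonalHom_fst_apply, h, diagonalHom_fst_apply]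

theorem mulEquiv_diagonalHom (d : polyModule A.1) :
    RepSpace.mulEquiv A (diagonalHom A d) =
      diagonalHom A ⟨matMap A.1 d, map_polyModule_le (AddSubgroup.mem_map_of_mem _ d.2)⟩ := by
  refine Prod.ext ?_ (AdicSpace.mulA_coe A _)
  ext i
  exact (RingHom.map_mulVec (algebraMap ℚ ℝ) A.1 d i).symm

theorem map_range_diagonalHom :
    (diagonalHom A).range.map (RepSpace.mulEquiv A : RepSpace A →+ RepSpace A) =
      (((polyModule A.1).map (matMap A.1)).addSubgroupOf (polyModule A.1)).map
        (diagonalHom A) := by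
  apply le_antisymm
  · rintro _ ⟨_, ⟨d, rfl⟩, rfl⟩
    exact ⟨_, AddSubgroup.mem_map_of_mem (matMap A.1) d.2, (mulEquiv_diagonalHom A d).symm⟩
  · rintro _ ⟨⟨_, hd'⟩, ⟨d, hd, rfl⟩, rfl⟩
    exact ⟨_, ⟨⟨d, hd⟩, rfl⟩, mulEquiv_diagonalHom A ⟨d, hd⟩⟩

theorem map_range_diagonalHom_le :
    (diagonalHom A).range.map (RepSpace.mulEquiv A : RepSpace A →+ RepSpace A) ≤
      (diagonalHom A).range :=
  (map_range_diagonalHom A).trans_le (AddSubgroup.map_le_range _ _)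

theorem relIndex_map_range_diagonalHom :
    ((diagonalHom A).range.map (RepSpace.mulEquiv A : RepSpace A →+ RepSpace A)).relIndex
      (diagonalHom A).range = residueCard A.1 := by
  rw [map_range_diagonalHom, AddMonoidHom.range_eq_map,
    AddSubgroup.relIndex_map_map_of_injective _ _ (diagonalHom_injective A),
    AddSubgroup.relIndex_top_right, residueCard_eq]
  rfl

theorem finite_range_diagonalHom_inter_closedBall (R : ℝ) :
    (((diagonalHom A).range : Set (RepSpace A)) ∩ Metric.closedBall 0 R).Finite := by
  obtain ⟨k, hk⟩ := pow_unbounded_of_one_lt R one_lt_two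
  obtain ⟨N, hN⟩ := exists_polyModule_inf_filt_inv_le (isUnit_det A) k
  obtain ⟨c, hc, hcN⟩ := exists_nsmul_mem_intVectors A.1 N
  refine (((finite_setOf_nsmul_mem_intVectors hc R).preimage
    Subtype.val_injective.injOn).image (diagonalHom A)).subset ?_
  rintro _ ⟨⟨d, rfl⟩, hd⟩
  rw [mem_closedBall_zero_iff] at hd
  have hadic : adicAbs A.1⁻¹ d < 2 ^ k := by
    refine lt_of_le_of_lt ?_ hk
    exact ((Completion.norm_coe (polyToLaurent A d)).symm.trans_le
      (norm_snd_le (diagonalHom A d))).trans hd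
  refine ⟨d, ⟨hcN _ (hN ⟨d.2, ?_⟩), fun i => ?_⟩, rfl⟩
  · exact mem_filt_of_adicAbs_lt (isUnit_det_inv A) (polyToLaurent A d).2 hadic
  · exact (PiLp.norm_apply_le (diagonalHom A d).1 i).trans ((norm_fst_le _).trans hd)

theorem laurentModule_le_sup (C : Matrix (Fin n) (Fin n) ℚ) :
    laurentModule C ≤ polyModule C ⊔ polyModule C⁻¹ := by
  refine iSup_le fun k => ?_
  obtain ⟨j, rfl | rfl⟩ := k.eq_nat_or_neg
  · rw [zpow_natCast]
    exact le_sup_of_le_left (le_iSup (fun j : ℕ => (intVectors n).map (matMap (C ^ j))) j)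
  · rw [Matrix.zpow_neg_natCast, ← Matrix.inv_pow']
    exact le_sup_of_le_right (le_iSup (fun j : ℕ => (intVectors n).map (matMap (C⁻¹ ^ j))) j)

/-- A compact set meeting every coset of the lattice `φ(ℤⁿ[A])`. -/
def coveringBox : Set (RepSpace A) :=
  (WithLp.toLp 2 '' Set.Icc 0 1) ×ˢ (Metric.closedBall 0 1 + Metric.closedBall 0 1)

theorem isCompact_coveringBox : IsCompact (coveringBox A) :=
  (isCompact_Icc.image (PiLp.continuous_toLp 2 _)).prod
    ((AdicSpace.isCompact_closedBall A).add (AdicSpace.isCompact_closedBall A))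

theorem range_diagonalHom_add_coveringBox :
    ((diagonalHom A).range : Set (RepSpace A)) + coveringBox A = univ := by
  refine eq_univ_of_forall fun ⟨x, y⟩ => ?_
  obtain ⟨y₀, hy₀⟩ : ∃ y₀ : LaurentGroup A, ‖y - (y₀ : AdicSpace A)‖ ≤ 1 := by
    obtain ⟨y₀, hy₀⟩ := Completion.denseRange_coe.exists_dist_lt y one_pos
    exact ⟨y₀, (dist_eq_norm y _ ▸ hy₀).le⟩
  obtain ⟨q, hq, p, hp, hqp⟩ := AddSubgroup.mem_sup.1 (laurentModule_le_sup _ y₀.2)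
  rw [Matrix.nonsing_inv_nonsing_inv _ (isUnit_det A)] at hp
  let v : Fin n → ℤ := fun i => ⌊x i - p i⌋
  have hv : castVec n v ∈ intVectors n := ⟨v, rfl⟩
  let d : polyModule A.1 := ⟨p + castVec n v, add_mem hp (intVectors_le hv)⟩
  have hreal : x - (diagonalHom A d).1 = WithLp.toLp 2 fun i => Int.fract (x i - p i) := by
    ext i
    simp [diagonalHom_fst_apply, d, castVec, ← Int.self_sub_floor, v, sub_sub]
  have hadic : ‖y₀ - polyToLaurent A d‖ ≤ 1 := by
    have hval : LaurentGroup.val A (y₀ - polyToLaurent A d) = q - castVec n v := by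
      rw [map_sub]
      change (y₀.1 : Fin n → ℚ) - (p + castVec n v) = _
      rw [← hqp]
      abel
    rw [LaurentGroup.norm_def, hval]
    have h := adicAbs_le_of_mem (k := 0) (isUnit_det_inv A)
      (by rw [filt_zero]; exact sub_mem hq (intVectors_le hv))
    rwa [neg_zero, zpow_zero] at h
  refine ⟨diagonalHom A d, ⟨d, rfl⟩, (x, y) - diagonalHom A d, ⟨?_, ?_⟩, add_sub_cancel _ _⟩
  · rw [Prod.fst_sub, hreal]
    exact mem_image_of_mem _ ⟨fun i => Int.fract_nonneg _, fun i => (Int.fract_lt_one _).le⟩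
  · refine ⟨y - y₀, mem_closedBall_zero_iff.2 hy₀, y₀ - (polyToLaurent A d : AdicSpace A), ?_,
      sub_add_sub_cancel _ _ _⟩
    rwa [mem_closedBall_zero_iff, ← Completion.coe_sub, Completion.norm_coe]

theorem residueCard_le_addEquivAddHaarChar :
    (residueCard A.1 : ℝ≥0) ≤ addEquivAddHaarChar (RepSpace.mulEquiv A) := by
  rw [← relIndex_map_range_diagonalHom]
  exact (RepSpace.isExpansion_mulEquiv A).relIndex_le_addEquivAddHaarChar
    (map_range_diagonalHom_le A) (finite_range_diagonalHom_inter_closedBall A)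
    (isCompact_coveringBox A) (range_diagonalHom_add_coveringBox A)

end DiagonalLattice

theorem isSelfAffine_iff {n : ℕ} (A : ExpandingMatrix n) (D : Finset (polyModule A.1))
    (F : Set (RepSpace A)) :
    IsSelfAffine A D F ↔
      F.Nonempty ∧ IsCompact F ∧ RepSpace.mulEquiv A '' F = diagonalHom A '' D + F := by
  have hunion : ⋃ d ∈ D, (fun z => z + diagonal A (polyToLaurent A d)) '' F =
      diagonalHom A '' D + F := by
    rw [add_comm, ← iUnion_add_right_image, biUnion_image]
    rfl
  exact ⟨fun h => ⟨h.nonempty, h.isCompact, h.setEquation.trans hunion⟩,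
    fun ⟨hFn, hFc, hF⟩ => ⟨hFn, hFc, hF.trans hunion.symm⟩⟩

end RationalTile

end

open RationalTile

theorem mainTheorem3 {n : ℕ} (A : RationalTile.ExpandingMatrix n)
    (D : Finset (RationalTile.polyModule A.1)) (hD : RationalTile.IsDigitSystem A D) :
    (∃! F : Set (RationalTile.RepSpace A), RationalTile.IsSelfAffine A D F) ∧
      ∀ F : Set (RationalTile.RepSpace A), RationalTile.IsSelfAffine A D F →
        List.TFAE
          [0 < RationalTile.RepSpace.measure A F,
            (interior F).Nonempty,
            F = closure (interior F) ∧ RationalTile.RepSpace.measure A (frontier F) = 0] := by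
  have hT := RepSpace.isExpansion_mulEquiv A
  have hcard : (diagonalHom A '' (D : Set (polyModule A.1))).ncard = residueCard A.1 := by
    rw [Set.ncard_image_of_injective _ (diagonalHom_injective A), Set.ncard_coe_finset, hD]
  have hfin := (D.finite_toSet).image (diagonalHom A)
  have hne : (diagonalHom A '' (D : Set (polyModule A.1))).Nonempty :=
    Set.nonempty_of_ncard_ne_zero (hcard.trans_ne (residueCard_ne_zero (isUnit_det A)))
  simp only [isSelfAffine_iff]
  refine ⟨existsUnique_of_exists_of_unique (hT.exists_isCompact hfin.isCompact hne) ?_, ?_⟩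
  · rintro F G ⟨hFn, hFc, hF⟩ ⟨hGn, hGc, hG⟩
    exact hT.eq_of_isCompact hFc hFn hF hGc hGn hG
  · rintro F ⟨hFn, hFc, hF⟩
    refine hT.tfae_measure_pos_interior _ hFc hFn hF (map_range_diagonalHom_le A)
      (finite_range_diagonalHom_inter_closedBall A) hfin (Set.image_subset_range _ _) ?_
    rw [hcard]
    exact residueCard_le_addEquivAddHaarChar A
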